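/- **Setup.** A multi-sender unicast index-coding problem has $N$ independent messages $M_1,\dots,M_N$, receivers $j\in[N]$ (receiver $j$ wants $M_j$ and knows $M_i$, $i\in\mathcal A_j\subseteq[N]\setminus\{j\}$), and $K$ senders; sender $k$ holds $M_i$, $i\in\mathcal S_k$ (the $\mathcal S_k$ are distinct and $\bigcup_k\mathcal S_k=[N]$), and has a noiseless broadcast link of capacity $C_k>0$ to all receivers. In a code of block length $n$ for the rate tuple $R\in\mathbb R_+^N$, $M_j$ is uniform on a set of size $2^{\lceil nR_j\rceil}$, sender $k$ maps its messages to an index from a set of size $2^{\lfloor nC_k\rfloor}$, and each receiver estimates its message from all indices and its side information. $R$ is achievable if there are codes whose probability that some receiver errs tends to $0$ as $n\to\infty$; the capacity region $\mathcal C$ is the closure of the set of achievable tuples. The MAIS region $\mathcal R_{\rm out}$ is the set of $R\in\mathbb R^N_+$ with $\sum_{j\in T}R_j\le\sum_{k:\mathcal S_k\cap T\ne\emptyset}C_k$ for each $T\subseteq[N]$ that induces an acyclic subgraph of the digraph with arcs $i\to j$ for $j\in\mathcal A_i$. **Composite coding regions.** For a nonempty sender group $P\subseteq[K]$ let $\mathcal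 S_P=\bigcup_{k\in P}\mathcal S_k$, $\mathcal A_{j,P}=\mathcal A_j\cap\mathcal S_P$, $\mathcal I_Q=\bigcup_{k\in Q}2^{\mathcal S_k}$. For $c=(c_k)_{k\in P}$ let $\mathcal R^{\rm CCC}_{P}(c)$ be the set of $(r_j)_{j\in\mathcal S_P}\ge0$ such that, for some sets $D_j$ with $j\in D_j\subseteq\mathcal S_P\setminus\mathcal A_{j,P}$ and some $\gamma_J\ge0$ ($J\in\mathcal I_P$), for all $j\in\mathcal S_P$, $$\sum_{i\in T}r_i<\sum_{J\in\mathcal I_P:\ J\subseteq D_j\cup\mathcal A_{j,P},\ J\cap T\neq\emptyset}\gamma_J\quad(\emptyset\ne T\subseteq D_j),\qquad \sum_{J\in\mathcal I_Q\setminus\mathcal I_{P\setminus Q}:\ J\not\subseteq\mathcal A_{j,P}}\gamma_J<\sum_{k\in Q}c_k\quad(\emptyset\neq Q\subseteq P).$$ Let $\mathcal R^{\rm DCC}_{P}(c)$ be defined in the same way, but with rates $\gamma^{(k)}_J\ge0$ ($k\in P$, $J\subseteq\mathcal S_k$) and the conditions $$\sum_{i\in T}r_i<\sum_{J\subseteq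 D_j\cup\mathcal A_{j,P},\ J\cap T\ne\emptyset}\ \sum_{k\in P:\,J\subseteq\mathcal S_k}\gamma^{(k)}_J\quad(\emptyset\ne T\subseteq D_j),\qquad \sum_{J\subseteq\mathcal S_k:\ J\not\subseteq\mathcal A_{j,P}}\gamma^{(k)}_J<c_k\quad(k\in P).$$ For a set $\Pi$ of nonempty sender groups with union $[K]$, a link split is $(c_{k,P})_{k\in P\in\Pi}$ with $c_{k,P}>0$ and $\sum_{P\in\Pi:\,k\in P}c_{k,P}\le C_k$. Let $\mathcal R_{\rm CLS}(\Pi)$ be the set of $R$ with $R_j=\sum_{P\in\Pi:\,j\in\mathcal S_P}r_{j,P}$, where $(r_{j,P})_{j\in\mathcal S_P}\in\mathcal R^{\rm CCC}_P((c_{k,P})_{k\in P})$ for all $P\in\Pi$, for some link split $c$; let $\mathcal R_{\rm LS}(\Pi)$ be defined in the same way with $\mathcal R^{\rm DCC}$. Put $\mathcal R_{\rm CLS}=\operatorname{conv}\bigcup_\Pi\mathcal R_{\rm CLS}(\Pi)$ and $\mathcal R_{\rm LS}=\operatorname{conv}\bigcup_\Pi\mathcal R_{\rm LS}(\Pi)$.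 Let $\mathcal R_{\rm CS}$ be the convex hull of the union, over the partitions $\Pi$ of $[K]$, of the CCC regions with $c_{k,P}=C_k$. **Theorem.** Consider $K=3$, $N=5$, $\mathcal S_1=\{1,2,3\}$, $\mathcal S_2=\{2,3,4\}$, $\mathcal S_3=\{1,2,4,5\}$, $C_1=C_2=C_3=1$, $\mathcal A_1=\{4,5\}$, $\mathcal A_2=\{1,3,5\}$, $\mathcal A_3=\{1,2\}$, $\mathcal A_4=\{2,3,5\}$, $\mathcal A_5=\{3\}$. 1. $\mathcal R_{\rm out}$ is the set of $R\in\mathbb R_+^5$ with $R_3\le2$, $R_5\le1$, $R_1+R_3\le3$, $R_1+R_5\le2$, $R_4+R_5\le2$, $R_1+R_2+R_5\le3$, $R_1+R_4+R_5\le3$, $R_2+R_4+R_5\le3$, $R_3+R_4+R_5\le3$. 2. For the admissible set of groups $\Pi^*=\{\{1,2\},\{2,3\},\{1,3\}\}$, $\mathcal R_{\rm CLS}(\Pi^*)$ is the set of $R\in\mathbb R_+^5$ that satisfy these nine inequalities strictly, and $\overline{\mathcal R_{\rm CLS}(\Pi^*)}=\overline{\mathcal R_{\rm CLS}}=\mathcal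 C=\mathcal R_{\rm out}$. 3. The tuple $(1.5,1,1.5,1,0.5)$ lies in $\mathcal R_{\rm out}$ but not in $\overline{\mathcal R_{\rm CS}}$, and $\mathcal R_{\rm CS}\subsetneq\mathcal R_{\rm CLS}$. 4. $\mathcal R_{\rm LS}\subsetneq\mathcal R_{\rm CLS}$, and $\overline{\mathcal R_{\rm LS}}\subsetneq\mathcal C$. Moreover, $\mathcal R_{\rm CS}\subseteq\mathcal R_{\rm CLS}$ and $\mathcal R_{\rm LS}\subseteq\mathcal R_{\rm CLS}$ for every multi-sender index-coding problem. -/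

import Mathlib

open Filter Topology

noncomputable section

namespace MultiSender

/-- A multi-sender unicast index-coding problem with `K` senders and `N` messages/receivers:
sender `k` holds the messages in `msgs k` and has a broadcast link of capacity `cap k` bits per
channel use; receiver `j` wants message `j` and knows the messages in `side j`. -/
structure Problem (K N : ℕ) where
  msgs : Fin K → Finset (Fin N)
  side : Fin N → Finset (Fin N)
  cap : Fin K → ℝ
  msgs_injective : Function.Injective msgs
  msgs_cover : Finset.univ.biUnion msgs = Finset.univ
  side_irrefl : ∀ j, j ∉ side j
  cap_pos : ∀ k, 0 < cap k

namespace Problem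

variable {K N : ℕ}

/-! ### Index codes and the capacity region -/

/-- Tuples of messages: `M_j` takes `2 ^ ⌈n R_j⌉` values. -/
abbrev Messages (R : Fin N → ℝ) (n : ℕ) : Type := (j : Fin N) → Fin (2 ^ ⌈(n : ℝ) * R j⌉₊)

/-- Tuples of sender outputs: `L_k` takes `2 ^ ⌊n C_k⌋` values. -/
abbrev Outputs (p : Problem K N) (n : ℕ) : Type :=
  (k : Fin K) → Fin (2 ^ ⌊(n : ℝ) * p.cap k⌋₊)

/-- The messages whose indices lie in `A`. -/
abbrev MessagesOn (A : Finset (Fin N)) (R : Fin N → ℝ) (n : ℕ) : Type :=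
  (i : {i : Fin N // i ∈ A}) → Fin (2 ^ ⌈(n : ℝ) * R i⌉₊)

/-- A multi-sender index code of block length `n` for the rate tuple `R`. -/
structure IndexCode (p : Problem K N) (R : Fin N → ℝ) (n : ℕ) where
  enc : (k : Fin K) → MessagesOn (p.msgs k) R n → Fin (2 ^ ⌊(n : ℝ) * p.cap k⌋₊)
  dec : (j : Fin N) → p.Outputs n → MessagesOn (p.side j) R n → Fin (2 ^ ⌈(n : ℝ) * R j⌉₊)

/-- The outputs of all senders for the messages `m`. -/
def IndexCode.outputs {p : Problem K N} {R : Fin N → ℝ} {n : ℕ} (code : p.IndexCode R n)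
    (m : Messages R n) : p.Outputs n :=
  fun k => code.enc k (fun i => m i)

/-- The estimate of message `j` formed by receiver `j` for the messages `m`. -/
def IndexCode.estimate {p : Problem K N} {R : Fin N → ℝ} {n : ℕ} (code : p.IndexCode R n)
    (m : Messages R n) (j : Fin N) : Fin (2 ^ ⌈(n : ℝ) * R j⌉₊) :=
  code.dec j (code.outputs m) (fun i => m i)

/-- The probability, for independent uniformly distributed messages, that some receiver is wrong. -/
def IndexCode.errorProb {p : Problem K N} {R : Fin N → ℝ} {n : ℕ} (code : p.IndexCode R n) : ℝ :=
  (Nat.card {m : Messages R n // ∃ j, code.estimate m j ≠ m j} : ℝ) / Nat.card (Messages R n)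

/-- A (nonnegative) rate tuple is achievable if some sequence of codes has vanishing error. -/
def Achievable (p : Problem K N) (R : Fin N → ℝ) : Prop :=
  (∀ j, 0 ≤ R j) ∧
    ∃ code : (n : ℕ) → p.IndexCode R n, Tendsto (fun n => (code n).errorProb) atTop (𝓝 0)

/-- The capacity region. -/
def capacityRegion (p : Problem K N) : Set (Fin N → ℝ) := closure {R | p.Achievable R}

/-! ### The MAIS outer bound -/

/-- The side-information digraph: an arc from `i` to `j` iff receiver `i` knows message `j`. -/
def sideGraph (p : Problem K N) : Digraph (Fin N) where
  Adj i j := j ∈ p.side i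

/-- The subgraph of the side-information digraph induced by `T` has no directed cycle. -/
def AcyclicOn (p : Problem K N) (T : Finset (Fin N)) : Prop :=
  ∀ j, ¬ Relation.TransGen (fun a b => a ∈ T ∧ b ∈ T ∧ p.sideGraph.Adj a b) j j

/-- The region of nonnegative tuples cut out by the MAIS (maximum acyclic induced subgraph)
outer bound. -/
def maisRegion (p : Problem K N) : Set (Fin N → ℝ) :=
  {R | (∀ j, 0 ≤ R j) ∧ ∀ T : Finset (Fin N), p.AcyclicOn T →
    ∑ j ∈ T, R j ≤ ∑ k with (p.msgs k ∩ T).Nonempty, p.cap k}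

/-! ### Sender groups -/

/-- The messages available in the sender group `P`. -/
def groupMsgs (p : Problem K N) (P : Finset (Fin K)) : Finset (Fin N) := P.biUnion p.msgs

/-- The side information of receiver `j` within the sender group `P`. -/
def groupSide (p : Problem K N) (P : Finset (Fin K)) (j : Fin N) : Finset (Fin N) :=
  p.side j ∩ p.groupMsgs P

/-- The index sets of composite messages available at some sender in `Q`. (The empty index set
is listed as well, but its rate occurs in none of the rate constraints below.) -/
def composites (p : Problem K N) (Q : Finset (Fin K)) : Finset (Finset (Fin N)) :=
  Q.biUnion fun k => (p.msgs k).powerset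

/-- `D j` is the set of messages decoded by receiver `j` from the group `P`. -/
def IsDecodingChoice (p : Problem K N) (P : Finset (Fin K)) (D : Fin N → Finset (Fin N)) : Prop :=
  ∀ j ∈ p.groupMsgs P, j ∈ D j ∧ D j ⊆ p.groupMsgs P \ p.groupSide P j

/-- A set of nonempty (automatically distinct) sender groups that covers all senders. -/
def IsGrouping (Gs : Finset (Finset (Fin K))) : Prop :=
  (∀ P ∈ Gs, P.Nonempty) ∧ Gs.biUnion id = Finset.univ

/-- A partition of the senders into disjoint groups. -/
def IsSenderPartition (Gs : Finset (Finset (Fin K))) : Prop :=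
  IsGrouping Gs ∧ ∀ P ∈ Gs, ∀ Q ∈ Gs, P ≠ Q → Disjoint P Q

/-- `c P k` is the positive part of the capacity of sender `k` allocated to the group `P`. -/
def IsLinkSplit (p : Problem K N) (Gs : Finset (Finset (Fin K)))
    (c : Finset (Fin K) → Fin K → ℝ) : Prop :=
  (∀ P ∈ Gs, ∀ k ∈ P, 0 < c P k) ∧ ∀ k, ∑ P ∈ Gs with k ∈ P, c P k ≤ p.cap k

/-- Rate tuples that are sums over the groups of `Gs` of tuples from `region P`; the tuple of the
group `P` only has the components `j ∈ p.groupMsgs P`. -/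
def combine (p : Problem K N) (Gs : Finset (Finset (Fin K)))
    (region : Finset (Fin K) → Set (Fin N → ℝ)) : Set (Fin N → ℝ) :=
  {R | ∃ r : Finset (Fin K) → Fin N → ℝ, (∀ P ∈ Gs, r P ∈ region P) ∧
    ∀ j, R j = ∑ P ∈ Gs with j ∈ p.groupMsgs P, r P j}

/-! ### Cooperative composite coding (CCC) -/

/-- The rate region of CCC in the group `P` with link capacities `c` and decoding choice `D`.
Only the components `r j` with `j ∈ p.groupMsgs P` matter; `γ J` is the composite rate of `J`,
common to all senders of the group. -/
def cccGroupRegionAt (p : Problem K N) (P : Finset (Fin K)) (c : Fin K → ℝ)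
    (D : Fin N → Finset (Fin N)) : Set (Fin N → ℝ) :=
  {r | (∀ j ∈ p.groupMsgs P, 0 ≤ r j) ∧ ∃ γ : Finset (Fin N) → ℝ,
    (∀ J ∈ p.composites P, 0 ≤ γ J) ∧
    (∀ j ∈ p.groupMsgs P, ∀ T ⊆ D j, T.Nonempty →
      ∑ i ∈ T, r i <
        ∑ J ∈ p.composites P with J ⊆ D j ∪ p.groupSide P j ∧ (J ∩ T).Nonempty, γ J) ∧
    (∀ j ∈ p.groupMsgs P, ∀ Q ⊆ P, Q.Nonempty →
      ∑ J ∈ p.composites Q with J ∉ p.composites (P \ Q) ∧ ¬ J ⊆ p.groupSide P j, γ J <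
        ∑ k ∈ Q, c k)}

/-- The rate region of CCC in the group `P` with link capacities `c`. -/
def cccGroupRegion (p : Problem K N) (P : Finset (Fin K)) (c : Fin K → ℝ) : Set (Fin N → ℝ) :=
  ⋃ D ∈ {D | p.IsDecodingChoice P D}, p.cccGroupRegionAt P c D

/-- The rate region of CCC for the set of groups `Gs`, over all admissible link splits. -/
def cccRegion (p : Problem K N) (Gs : Finset (Finset (Fin K))) : Set (Fin N → ℝ) :=
  ⋃ c ∈ {c | p.IsLinkSplit Gs c}, p.combine Gs fun P => p.cccGroupRegion P (c P)

/-- `R_CLS`: CCC with joint link-and-sender partitioning. -/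
def regionCLS (p : Problem K N) : Set (Fin N → ℝ) :=
  convexHull ℝ (⋃ Gs ∈ {Gs | IsGrouping Gs}, p.cccRegion Gs)

/-- `R_CS`: CCC with sender partitioning; each sender spends its full capacity in its group. -/
def regionCS (p : Problem K N) : Set (Fin N → ℝ) :=
  convexHull ℝ (⋃ Gs ∈ {Gs | IsSenderPartition Gs},
    p.combine Gs fun P => p.cccGroupRegion P p.cap)

/-! ### Distributed composite coding (DCC), without cooperative compression -/

/-- The rate region of DCC in the group `P` with link capacities `c` and decoding choice `D`.
Here `γ k J` is the composite rate of `J` at sender `k`. -/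
def dccGroupRegionAt (p : Problem K N) (P : Finset (Fin K)) (c : Fin K → ℝ)
    (D : Fin N → Finset (Fin N)) : Set (Fin N → ℝ) :=
  {r | (∀ j ∈ p.groupMsgs P, 0 ≤ r j) ∧ ∃ γ : Fin K → Finset (Fin N) → ℝ,
    (∀ k ∈ P, ∀ J ⊆ p.msgs k, 0 ≤ γ k J) ∧
    (∀ j ∈ p.groupMsgs P, ∀ T ⊆ D j, T.Nonempty →
      ∑ i ∈ T, r i <
        ∑ J ∈ (D j ∪ p.groupSide P j).powerset with (J ∩ T).Nonempty,
          ∑ k ∈ P with J ⊆ p.msgs k, γ k J) ∧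
    (∀ j ∈ p.groupMsgs P, ∀ k ∈ P,
      ∑ J ∈ (p.msgs k).powerset with ¬ J ⊆ p.groupSide P j, γ k J < c k)}

/-- The rate region of DCC in the group `P` with link capacities `c`. -/
def dccGroupRegion (p : Problem K N) (P : Finset (Fin K)) (c : Fin K → ℝ) : Set (Fin N → ℝ) :=
  ⋃ D ∈ {D | p.IsDecodingChoice P D}, p.dccGroupRegionAt P c D

/-- `R_LS`: (modified) DCC with joint link-and-sender partitioning. -/
def regionLS (p : Problem K N) : Set (Fin N → ℝ) :=
  convexHull ℝ (⋃ Gs ∈ {Gs | IsGrouping Gs}, ⋃ c ∈ {c | p.IsLinkSplit Gs c},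
    p.combine Gs fun P => p.dccGroupRegion P (c P))

end Problem

/-! ### The instance with three senders and five messages (indices shifted to start at `0`) -/

/-- Senders `{1,2,3}`, `{2,3,4}`, `{1,2,4,5}` with unit links, and side information
`{4,5}`, `{1,3,5}`, `{1,2}`, `{2,3,5}`, `{3}`. -/
def threeSenders : Problem 3 5 where
  msgs := ![{0, 1, 2}, {1, 2, 3}, {0, 1, 3, 4}]
  side := ![{3, 4}, {0, 2, 4}, {0, 1}, {1, 2, 4}, {2}]
  cap := fun _ => 1
  msgs_injective := by decide
  msgs_cover := by decide
  side_irrefl := by decide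
  cap_pos := fun _ => one_pos

/-- The three pairs of senders. -/
def senderPairs : Finset (Finset (Fin 3)) := {{0, 1}, {1, 2}, {0, 2}}

end MultiSender

end

noncomputable section

namespace MultiSender

/-! ### Acyclic sets and the MAIS bound for composite coding. -/

namespace Problem

variable {K N : ℕ}

/-! All regions of the instance are compared with the MAIS region. The upper bounds rest on one
fact: a nonempty acyclic set of receivers contains a sink, a receiver with no side information in
the set (`AcyclicOn.exists_sink`). For composite coding, sinks are peeled off one at a time, and the
load condition of one sink then gives the MAIS inequality in strict form
(`sum_lt_of_mem_cccGroupRegion`, summed over groups in `sum_lt_of_mem_cccRegion`). For arbitrary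
codes, sinks show that correctly decoded messages in an acyclic set are determined by the messages
outside it and by the outputs of the senders that meet it. Counting then yields the bound
(`IndexCode.card_correct_mul_le`).

For the lower bounds, ten elementary modes each deliver one bit of some messages at the cost of one
bit on some links. Every tuple satisfying the nine inequalities is dominated by a mixture of modes
that loads each link by at most 1 (`NineBounds.exists_weights`). The modes are realized twice: as
cooperative composite coding inside a pair of senders (`mem_cccGroupRegionAt_of_modes`), and as XOR
codes without error (`hasZeroErrorCode_mode`), which run in parallel to give achievability directly.
Strict inequalities leave room for a scaling by `1 - δ`, which pays for all strict conditions and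
all rounding.

The two separations use half-spaces. With indices from 0, sender partitioning satisfies `2 R 0 + R 1
+ R 2 + R 3 + 2 R 4 ≤ 7`, and distributed composite coding satisfies `2 R 0 + R 1 + R 2 + R 3 ≤ 7`.
The MAIS region contains points where these sums are 15/2. Where the MAIS inequalities of a group
are too weak, the bounds follow from linear-programming duality, with one integer certificate for
each family of decoding choices (`sum_mul_le_of_certificate` and its distributed analogue). -/

theorem AcyclicOn.mono {p : Problem K N} {T V : Finset (Fin N)} (hT : p.AcyclicOn T)
    (h : V ⊆ T) : p.AcyclicOn V := fun j hj =>
  hT j (Relation.TransGen.mono (fun _ _ hab => ⟨h hab.1, h hab.2.1, hab.2.2⟩) j j hj)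

/-- A nonempty acyclic set contains a receiver without side information in the set. -/
theorem AcyclicOn.exists_sink {p : Problem K N} {T : Finset (Fin N)} (hT : p.AcyclicOn T)
    (hne : T.Nonempty) : ∃ j ∈ T, Disjoint (p.side j) T := by
  -- Reversed reachability is a strict order on a finite type, so `T` has a minimal element; it has
  -- no outgoing arc inside `T`.
  let s : Fin N → Fin N → Prop := fun a b =>
    Relation.TransGen (fun a b => a ∈ T ∧ b ∈ T ∧ p.sideGraph.Adj a b) b a
  have : IsTrans (Fin N) s := ⟨fun _ _ _ h₁ h₂ => h₂.trans h₁⟩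
  have : Std.Irrefl s := ⟨fun a h => hT a h⟩
  have wf : WellFounded s := Finite.wellFounded_of_trans_of_irrefl s
  obtain ⟨j, hj, hmin⟩ := wf.has_min (T : Set (Fin N)) hne
  refine ⟨j, hj, Finset.disjoint_left.2 fun i hi hiT => hmin i hiT ?_⟩
  exact Relation.TransGen.single ⟨hj, hiT, hi⟩

/-- A set is acyclic if some rank function decreases along its arcs. -/
theorem acyclicOn_of_rank {p : Problem K N} {T : Finset (Fin N)} (f : Fin N → ℕ)
    (h : ∀ a ∈ T, ∀ b ∈ T, b ∈ p.side a → f b < f a) : p.AcyclicOn T := by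
  have key : ∀ a b, Relation.TransGen
      (fun a b => a ∈ T ∧ b ∈ T ∧ p.sideGraph.Adj a b) a b → f b < f a := by
    intro a b hab
    induction hab with
    | single h1 => exact h _ h1.1 _ h1.2.1 h1.2.2
    | tail _ h1 ih => exact (h _ h1.1 _ h1.2.1 h1.2.2).trans ih
  exact fun j hj => (key j j hj).false

theorem mem_groupMsgs {p : Problem K N} {P : Finset (Fin K)} {j : Fin N} :
    j ∈ p.groupMsgs P ↔ ∃ k ∈ P, j ∈ p.msgs k := by
  simp [groupMsgs]

theorem mem_composites {p : Problem K N} {P : Finset (Fin K)} {J : Finset (Fin N)} :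
    J ∈ p.composites P ↔ ∃ k ∈ P, J ⊆ p.msgs k := by
  simp [composites]

theorem composites_mono (p : Problem K N) {P Q : Finset (Fin K)} (h : Q ⊆ P) :
    p.composites Q ⊆ p.composites P := Finset.biUnion_subset_biUnion_of_subset_left _ h

theorem exists_mem_msgs (p : Problem K N) (j : Fin N) : ∃ k, j ∈ p.msgs k := by
  have := p.msgs_cover ▸ Finset.mem_univ j
  simpa using this

/-- The messages of an acyclic set are conveyed by composite messages that meet the set. -/
theorem sum_le_sum_composites {p : Problem K N} {P : Finset (Fin K)}
    {D : Fin N → Finset (Fin N)} {r : Fin N → ℝ} {γ : Finset (Fin N) → ℝ}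
    (hD : p.IsDecodingChoice P D) (hγ : ∀ J ∈ p.composites P, 0 ≤ γ J)
    (hdec : ∀ j ∈ p.groupMsgs P, ∀ T ⊆ D j, T.Nonempty →
      ∑ i ∈ T, r i <
        ∑ J ∈ p.composites P with J ⊆ D j ∪ p.groupSide P j ∧ (J ∩ T).Nonempty, γ J)
    (V : Finset (Fin N)) : p.AcyclicOn V → V ⊆ p.groupMsgs P →
      ∑ i ∈ V, r i ≤ ∑ J ∈ p.composites P with (J ∩ V).Nonempty, γ J := by
  induction V using Finset.strongInduction with
  | H V ih =>
    intro hV hVP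
    rcases V.eq_empty_or_nonempty with rfl | hne
    · simp
    obtain ⟨j, hj, hsink⟩ := hV.exists_sink hne
    have hjD := (hD j (hVP hj)).1
    -- The sink's decoding condition accounts for `V ∩ D j`, and induction for `V \ D j`.
    have hlt := hdec j (hVP hj) (V ∩ D j) Finset.inter_subset_right
      ⟨j, Finset.mem_inter.2 ⟨hj, hjD⟩⟩
    have hss : V \ D j ⊂ V :=
      Finset.ssubset_iff_subset_ne.2 ⟨Finset.sdiff_subset, fun h => by
        have := h ▸ hj
        exact (Finset.mem_sdiff.1 this).2 hjD⟩
    have hle := ih _ hss (hV.mono hss.subset) (hss.subset.trans hVP)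
    -- No composite is counted twice: those used by the sink lie in `D j` and its side information,
    -- and `V \ D j` avoids both.
    have hdisj : Disjoint
        ((p.composites P).filter fun J => J ⊆ D j ∪ p.groupSide P j ∧ (J ∩ (V ∩ D j)).Nonempty)
        ((p.composites P).filter fun J => (J ∩ (V \ D j)).Nonempty) := by
      refine Finset.disjoint_left.2 fun J h1 h2 => ?_
      obtain ⟨i, hi⟩ := (Finset.mem_filter.1 h2).2
      obtain ⟨hiJ, hiV⟩ := Finset.mem_inter.1 hi
      obtain ⟨hiV, hiD⟩ := Finset.mem_sdiff.1 hiV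
      rcases Finset.mem_union.1 ((Finset.mem_filter.1 h1).2.1 hiJ) with h | h
      · exact hiD h
      · exact Finset.disjoint_left.1 hsink (Finset.mem_inter.1 h).1 hiV
    calc ∑ i ∈ V, r i = ∑ i ∈ V ∩ D j, r i + ∑ i ∈ V \ D j, r i :=
          (Finset.sum_inter_add_sum_sdiff V (D j) r).symm
      _ ≤ _ := add_le_add hlt.le hle
      _ = _ := (Finset.sum_union hdisj).symm
      _ ≤ _ := by
        refine Finset.sum_le_sum_of_subset_of_nonneg ?_ fun J hJ _ =>
          hγ J (Finset.mem_filter.1 hJ).1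
        intro J hJ
        rcases Finset.mem_union.1 hJ with h | h
        · obtain ⟨h1, -, i, hi⟩ := Finset.mem_filter.1 h
          refine Finset.mem_filter.2 ⟨h1, i, ?_⟩
          simp only [Finset.mem_inter] at hi ⊢
          exact ⟨hi.1, hi.2.1⟩
        · obtain ⟨h1, i, hi⟩ := Finset.mem_filter.1 h
          refine Finset.mem_filter.2 ⟨h1, i, ?_⟩
          simp only [Finset.mem_inter, Finset.mem_sdiff] at hi ⊢
          exact ⟨hi.1, hi.2.1⟩

/-- The MAIS bound, in its strict form, for cooperative composite coding in one group. -/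
theorem sum_lt_of_mem_cccGroupRegion {p : Problem K N} {P : Finset (Fin K)} {c : Fin K → ℝ}
    {r : Fin N → ℝ} (hr : r ∈ p.cccGroupRegion P c) {T : Finset (Fin N)} (hT : p.AcyclicOn T)
    (hTP : T ⊆ p.groupMsgs P) (hne : T.Nonempty) :
    ∑ i ∈ T, r i < ∑ k ∈ P with (p.msgs k ∩ T).Nonempty, c k := by
  simp only [cccGroupRegion, Set.mem_iUnion, Set.mem_ofPred_eq] at hr
  obtain ⟨D, hD, -, γ, hγ, hdec, hcap⟩ := hr
  refine (sum_le_sum_composites hD hγ hdec T hT hTP).trans_lt ?_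
  obtain ⟨j, hj, hsink⟩ := hT.exists_sink hne
  -- The load condition is used for the sink and all senders that meet `T`. A composite meeting `T`
  -- is held only by such senders, and it is never contained in the sink's side information.
  have hQ : (P.filter fun k => (p.msgs k ∩ T).Nonempty).Nonempty := by
    obtain ⟨k, hk, hjk⟩ := mem_groupMsgs.1 (hTP hj)
    exact ⟨k, Finset.mem_filter.2 ⟨hk, j, Finset.mem_inter.2 ⟨hjk, hj⟩⟩⟩
  refine lt_of_le_of_lt ?_ (hcap j (hTP hj) _ (Finset.filter_subset _ _) hQ)
  refine Finset.sum_le_sum_of_subset_of_nonneg ?_ fun J hJ _ =>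
    hγ J (p.composites_mono (Finset.filter_subset _ _) (Finset.mem_filter.1 hJ).1)
  intro J hJ
  obtain ⟨h1, i, hi⟩ := Finset.mem_filter.1 hJ
  obtain ⟨k, hk, hJk⟩ := mem_composites.1 h1
  obtain ⟨hiJ, hiT⟩ := Finset.mem_inter.1 hi
  refine Finset.mem_filter.2 ⟨mem_composites.2 ⟨k, Finset.mem_filter.2
    ⟨hk, i, Finset.mem_inter.2 ⟨hJk hiJ, hiT⟩⟩, hJk⟩, fun h => ?_, fun h => ?_⟩
  · obtain ⟨l, hl, hJl⟩ := mem_composites.1 h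
    obtain ⟨hlP, hl⟩ := Finset.mem_sdiff.1 hl
    exact hl (Finset.mem_filter.2 ⟨hlP, i, Finset.mem_inter.2 ⟨hJl hiJ, hiT⟩⟩)
  · exact Finset.disjoint_left.1 hsink (Finset.mem_inter.1 (h hiJ)).1 hiT

theorem sum_le_of_mem_cccGroupRegion {p : Problem K N} {P : Finset (Fin K)} {c : Fin K → ℝ}
    {r : Fin N → ℝ} (hr : r ∈ p.cccGroupRegion P c) {T : Finset (Fin N)} (hT : p.AcyclicOn T)
    (hTP : T ⊆ p.groupMsgs P) :
    ∑ i ∈ T, r i ≤ ∑ k ∈ P with (p.msgs k ∩ T).Nonempty, c k := by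
  rcases T.eq_empty_or_nonempty with rfl | hne
  · simp
  · exact (sum_lt_of_mem_cccGroupRegion hr hT hTP hne).le

theorem nonneg_of_mem_cccGroupRegion {p : Problem K N} {P : Finset (Fin K)} {c : Fin K → ℝ}
    {r : Fin N → ℝ} (hr : r ∈ p.cccGroupRegion P c) {j : Fin N} (hj : j ∈ p.groupMsgs P) :
    0 ≤ r j := by
  simp only [cccGroupRegion, Set.mem_iUnion] at hr
  obtain ⟨D, hD, h, -⟩ := hr
  exact h j hj

theorem nonneg_of_mem_combine {p : Problem K N} {Gs : Finset (Finset (Fin K))}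
    {c : Finset (Fin K) → Fin K → ℝ} {R : Fin N → ℝ}
    (hR : R ∈ p.combine Gs fun P => p.cccGroupRegion P (c P)) (j : Fin N) : 0 ≤ R j := by
  obtain ⟨r, hr, hR⟩ := hR
  rw [hR]
  refine Finset.sum_nonneg fun P hP => ?_
  obtain ⟨hP, hj⟩ := Finset.mem_filter.1 hP
  exact nonneg_of_mem_cccGroupRegion (hr P hP) hj

theorem sum_combine {p : Problem K N} {Gs : Finset (Finset (Fin K))}
    {r : Finset (Fin K) → Fin N → ℝ} (w : Fin N → ℝ) (T : Finset (Fin N)) :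
    ∑ j ∈ T, w j * ∑ P ∈ Gs with j ∈ p.groupMsgs P, r P j =
      ∑ P ∈ Gs, ∑ j ∈ T ∩ p.groupMsgs P, w j * r P j := by
  simp_rw [Finset.mul_sum, Finset.sum_filter]
  rw [Finset.sum_comm]
  refine Finset.sum_congr rfl fun P _ => ?_
  rw [← Finset.sum_filter, Finset.filter_mem_eq_inter]

/-- The group bounds add up because the split capacities of a link sum to at most its capacity. A
group disjoint from `T` contributes only an equality, so strictness comes from one group containing
a sender of some message in `T`. -/
theorem sum_lt_of_mem_cccRegion {p : Problem K N} {Gs : Finset (Finset (Fin K))}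
    (hGs : IsGrouping Gs) {R : Fin N → ℝ} (hR : R ∈ p.cccRegion Gs) {T : Finset (Fin N)}
    (hT : p.AcyclicOn T) (hne : T.Nonempty) :
    ∑ j ∈ T, R j < ∑ k with (p.msgs k ∩ T).Nonempty, p.cap k := by
  simp only [cccRegion, Set.mem_iUnion, Set.mem_ofPred_eq] at hR
  obtain ⟨c, hc, r, hr, hR⟩ := hR
  have hfil : ∀ P : Finset (Fin K), (P.filter fun k => (p.msgs k ∩ (T ∩ p.groupMsgs P)).Nonempty) =
      P.filter fun k => (p.msgs k ∩ T).Nonempty := by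
    refine fun P => Finset.filter_congr fun k hk => ?_
    have : p.msgs k ⊆ p.groupMsgs P := Finset.subset_biUnion_of_mem p.msgs hk
    rw [← Finset.inter_assoc, Finset.inter_eq_left.2 (Finset.inter_subset_left.trans this)]
  have h1 : ∑ j ∈ T, R j = ∑ P ∈ Gs, ∑ j ∈ T ∩ p.groupMsgs P, r P j := by
    have := sum_combine (p := p) (Gs := Gs) (r := r) (fun _ => 1) T
    simp only [one_mul] at this
    rw [← this]
    exact Finset.sum_congr rfl fun j _ => hR j
  have h2 : ∑ P ∈ Gs, ∑ j ∈ T ∩ p.groupMsgs P, r P j <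
      ∑ P ∈ Gs, ∑ k ∈ P with (p.msgs k ∩ T).Nonempty, c P k := by
    refine Finset.sum_lt_sum (fun P hP => ?_) ?_
    · rw [← hfil]
      exact sum_le_of_mem_cccGroupRegion (hr P hP) (hT.mono Finset.inter_subset_left)
        Finset.inter_subset_right
    · obtain ⟨j, hj⟩ := hne
      obtain ⟨k, hk⟩ := p.exists_mem_msgs j
      have : k ∈ Gs.biUnion id := hGs.2 ▸ Finset.mem_univ k
      obtain ⟨P, hP, hkP⟩ := Finset.mem_biUnion.1 this
      refine ⟨P, hP, ?_⟩
      rw [← hfil]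
      exact sum_lt_of_mem_cccGroupRegion (hr P hP) (hT.mono Finset.inter_subset_left)
        Finset.inter_subset_right ⟨j, Finset.mem_inter.2 ⟨hj, mem_groupMsgs.2 ⟨k, hkP, hk⟩⟩⟩
  rw [h1]
  refine h2.trans_le ?_
  calc ∑ P ∈ Gs, ∑ k ∈ P with (p.msgs k ∩ T).Nonempty, c P k
      = ∑ P ∈ Gs, ∑ k with (p.msgs k ∩ T).Nonempty, if k ∈ P then c P k else 0 := by
        refine Finset.sum_congr rfl fun P _ => ?_
        rw [← Finset.sum_filter]
        refine Finset.sum_congr ?_ fun _ _ => rfl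
        ext k; simp [and_comm]
    _ = ∑ k with (p.msgs k ∩ T).Nonempty, ∑ P ∈ Gs with k ∈ P, c P k := by
        rw [Finset.sum_comm]
        simp_rw [Finset.sum_filter]
    _ ≤ _ := Finset.sum_le_sum fun k _ => hc.2 k

theorem cccRegion_subset_maisRegion (p : Problem K N) {Gs : Finset (Finset (Fin K))}
    (hGs : IsGrouping Gs) : p.cccRegion Gs ⊆ p.maisRegion := by
  intro R hR
  refine ⟨fun j => ?_, fun T hT => ?_⟩
  · have h := hR
    simp only [cccRegion, Set.mem_iUnion] at h
    obtain ⟨c, -, h⟩ := h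
    exact nonneg_of_mem_combine h j
  · rcases T.eq_empty_or_nonempty with rfl | hne
    · simp
    · exact (sum_lt_of_mem_cccRegion hGs hR hT hne).le

theorem convex_maisRegion (p : Problem K N) : Convex ℝ p.maisRegion := by
  intro x hx y hy a b ha hb hab
  refine ⟨fun j => add_nonneg (mul_nonneg ha (hx.1 j)) (mul_nonneg hb (hy.1 j)), fun T hT => ?_⟩
  simp only [Pi.add_apply, Pi.smul_apply, smul_eq_mul, Finset.sum_add_distrib, ← Finset.mul_sum]
  have h1 := mul_le_mul_of_nonneg_left (hx.2 T hT) ha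
  have h2 := mul_le_mul_of_nonneg_left (hy.2 T hT) hb
  refine (add_le_add h1 h2).trans_eq ?_
  rw [← add_mul, hab, one_mul]

theorem isClosed_maisRegion (p : Problem K N) : IsClosed p.maisRegion := by
  have : p.maisRegion = (⋂ j, {R : Fin N → ℝ | 0 ≤ R j}) ∩
      ⋂ T : Finset (Fin N), ⋂ _ : p.AcyclicOn T,
        {R : Fin N → ℝ | ∑ j ∈ T, R j ≤ ∑ k with (p.msgs k ∩ T).Nonempty, p.cap k} := by
    ext R; simp [maisRegion]
  rw [this]
  refine (isClosed_iInter fun j => isClosed_le continuous_const (continuous_apply j)).inter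
    (isClosed_iInter fun T => isClosed_iInter fun _ => isClosed_le ?_ continuous_const)
  fun_prop

theorem regionCLS_subset_maisRegion (p : Problem K N) : p.regionCLS ⊆ p.maisRegion :=
  convexHull_min (Set.iUnion₂_subset fun _ h => p.cccRegion_subset_maisRegion h)
    p.convex_maisRegion

/-! ### Inclusions valid for every problem. -/

/-- Without cooperative compression the composite rates of the senders add up. -/
theorem dccGroupRegion_subset_cccGroupRegion (p : Problem K N) (P : Finset (Fin K))
    (c : Fin K → ℝ) : p.dccGroupRegion P c ⊆ p.cccGroupRegion P c := by
  refine Set.iUnion₂_mono fun D _ => ?_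
  rintro r ⟨hr, γ, hγ, hdec, hcap⟩
  refine ⟨hr, fun J => ∑ k ∈ P with J ⊆ p.msgs k, γ k J, fun J _ => ?_, fun j hj T hT hne => ?_,
    fun j hj Q hQP hQ => ?_⟩
  · refine Finset.sum_nonneg fun k hk => ?_
    obtain ⟨h1, h2⟩ := Finset.mem_filter.1 hk
    exact hγ k h1 J h2
  · refine (hdec j hj T hT hne).trans_eq (Eq.symm ?_)
    refine Finset.sum_subset (fun J hJ => ?_) fun J hJ hJ' => ?_
    · simp only [Finset.mem_filter, Finset.mem_powerset] at hJ ⊢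
      exact hJ.2
    · refine Finset.sum_eq_zero fun k hk => absurd ?_ hJ'
      obtain ⟨h1, h2⟩ := Finset.mem_filter.1 hk
      simp only [Finset.mem_filter, Finset.mem_powerset] at hJ ⊢
      exact ⟨mem_composites.2 ⟨k, h1, h2⟩, hJ⟩
  · refine lt_of_le_of_lt ?_ (Finset.sum_lt_sum_of_nonempty hQ fun k hk => hcap j hj k (hQP hk))
    -- A composite held by no sender of `P \ Q` has all its holders within `Q`, so its pooled rate
    -- is a sum over `Q`, bounded sender by sender.
    calc _ = ∑ J ∈ p.composites Q with J ∉ p.composites (P \ Q) ∧ ¬ J ⊆ p.groupSide P j,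
            ∑ k ∈ Q, if J ⊆ p.msgs k then γ k J else 0 := by
          refine Finset.sum_congr rfl fun J hJ => ?_
          rw [← Finset.sum_filter]
          refine Finset.sum_congr ?_ fun _ _ => rfl
          ext k
          simp only [Finset.mem_filter, and_congr_left_iff]
          refine fun hJk => ⟨fun hk => ?_, fun hk => hQP hk⟩
          by_contra hkQ
          exact (Finset.mem_filter.1 hJ).2.1
            (mem_composites.2 ⟨k, Finset.mem_sdiff.2 ⟨hk, hkQ⟩, hJk⟩)
      _ ≤ _ := by
          rw [Finset.sum_comm]
          refine Finset.sum_le_sum fun k hk => ?_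
          rw [← Finset.sum_filter]
          refine Finset.sum_le_sum_of_subset_of_nonneg (fun J hJ => ?_) fun J hJ _ => ?_
          · simp only [Finset.mem_filter, Finset.mem_powerset] at hJ ⊢
            exact ⟨hJ.2, hJ.1.2.2⟩
          · exact hγ k (hQP hk) J (Finset.mem_powerset.1 (Finset.mem_filter.1 hJ).1)

theorem regionLS_subset_regionCLS (p : Problem K N) : p.regionLS ⊆ p.regionCLS := by
  refine convexHull_mono (Set.iUnion₂_mono fun Gs _ => Set.iUnion₂_mono fun c _ => ?_)
  rintro R ⟨r, hr, hR⟩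
  exact ⟨r, fun P hP => p.dccGroupRegion_subset_cccGroupRegion P _ (hr P hP), hR⟩

/-- In a partition each sender lies in at most one group, so giving every group the full capacities
is an admissible link split. -/
theorem regionCS_subset_regionCLS (p : Problem K N) : p.regionCS ⊆ p.regionCLS := by
  refine convexHull_mono (Set.iUnion₂_subset fun Gs hGs => ?_)
  refine fun R hR => Set.mem_iUnion₂.2 ⟨Gs, hGs.1, Set.mem_iUnion₂.2 ⟨fun _ => p.cap, ⟨?_, ?_⟩, hR⟩⟩
  · exact fun P _ k _ => p.cap_pos k
  · intro k
    rw [Finset.sum_const, nsmul_eq_mul]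
    refine mul_le_of_le_one_left (p.cap_pos k).le ?_
    rw [Nat.cast_le_one, Finset.card_le_one]
    intro P hP Q hQ
    simp only [Finset.mem_filter] at hP hQ
    by_contra hne
    exact Finset.disjoint_left.1 (hGs.2 P hP.1 Q hQ.1 hne) hP.2 hQ.2

end Problem

/-! ### The nine inequalities of the instance. -/

open Problem

/-- The nine inequalities that describe the capacity region of `threeSenders`. -/
def NineBounds (R : Fin 5 → ℝ) : Prop :=
  R 2 ≤ 2 ∧ R 4 ≤ 1 ∧ R 0 + R 2 ≤ 3 ∧ R 0 + R 4 ≤ 2 ∧ R 3 + R 4 ≤ 2 ∧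
    R 0 + R 1 + R 4 ≤ 3 ∧ R 0 + R 3 + R 4 ≤ 3 ∧ R 1 + R 3 + R 4 ≤ 3 ∧ R 2 + R 3 + R 4 ≤ 3

/-- The strict form of `NineBounds`. -/
def NineStrictBounds (R : Fin 5 → ℝ) : Prop :=
  R 2 < 2 ∧ R 4 < 1 ∧ R 0 + R 2 < 3 ∧ R 0 + R 4 < 2 ∧ R 3 + R 4 < 2 ∧
    R 0 + R 1 + R 4 < 3 ∧ R 0 + R 3 + R 4 < 3 ∧ R 1 + R 3 + R 4 < 3 ∧ R 2 + R 3 + R 4 < 3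

/-- The message sets on the left-hand sides of `NineBounds`. -/
def nineSets : List (Finset (Fin 5)) :=
  [{2}, {4}, {0, 2}, {0, 4}, {3, 4}, {0, 1, 4}, {0, 3, 4}, {1, 3, 4}, {2, 3, 4}]

theorem acyclicOn_of_mem_nineSets {T : Finset (Fin 5)} (hT : T ∈ nineSets) :
    threeSenders.AcyclicOn T := by
  have key : ∀ f : Fin 5 → ℕ, (∀ a ∈ T, ∀ b ∈ T, b ∈ threeSenders.side a → f b < f a) →
      threeSenders.AcyclicOn T := fun f h => acyclicOn_of_rank f h
  simp only [nineSets, List.mem_cons, List.not_mem_nil, or_false] at hT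
  rcases hT with rfl | rfl | rfl | rfl | rfl | rfl | rfl | rfl | rfl
  -- The vectors are topological orders of the induced subgraphs, sinks ranked lowest.
  · exact key (fun _ => 0) (by decide)
  · exact key (fun _ => 0) (by decide)
  · exact key ![0, 0, 1, 0, 0] (by decide)
  · exact key ![1, 0, 0, 0, 0] (by decide)
  · exact key ![0, 0, 0, 1, 0] (by decide)
  · exact key ![1, 2, 0, 0, 0] (by decide)
  · exact key ![2, 0, 0, 1, 0] (by decide)
  · exact key ![0, 1, 0, 2, 0] (by decide)
  · exact key ![0, 0, 0, 2, 1] (by decide)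

/-- Enlarging an acyclic set without meeting more senders only strengthens its inequality for
nonnegative rates, so the nine sets suffice. The empty set meets no sender and is set apart. Of
acyclicity only the absence of four short cycles is needed; this turns the claim into a check over
32 subsets. -/
theorem exists_nineSets_superset {T : Finset (Fin 5)} (hT : threeSenders.AcyclicOn T) :
    ∃ F ∈ nineSets, T ⊆ F ∧ (Finset.univ.filter fun k => (threeSenders.msgs k ∩ F).Nonempty).card ≤
      (Finset.univ.filter fun k => (threeSenders.msgs k ∩ T).Nonempty).card ∨ T = ∅ := by
  have arc : ∀ {a b : Fin 5}, a ∈ T → b ∈ T → b ∈ threeSenders.side a → Relation.TransGen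
      (fun a b => a ∈ T ∧ b ∈ T ∧ threeSenders.sideGraph.Adj a b) a b :=
    fun ha hb h => Relation.TransGen.single ⟨ha, hb, h⟩
  have h1 : ¬ ((1 : Fin 5) ∈ T ∧ (2 : Fin 5) ∈ T) := fun ⟨h1, h2⟩ =>
    hT 1 ((arc h1 h2 (by decide)).trans (arc h2 h1 (by decide)))
  have h2 : ¬ ((0 : Fin 5) ∈ T ∧ (3 : Fin 5) ∈ T ∧ (1 : Fin 5) ∈ T) := fun ⟨h0, h3, h1⟩ =>
    hT 0 (((arc h0 h3 (by decide)).trans (arc h3 h1 (by decide))).trans (arc h1 h0 (by decide)))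
  have h3 : ¬ ((0 : Fin 5) ∈ T ∧ (3 : Fin 5) ∈ T ∧ (2 : Fin 5) ∈ T) := fun ⟨h0, h3, h1⟩ =>
    hT 0 (((arc h0 h3 (by decide)).trans (arc h3 h1 (by decide))).trans (arc h1 h0 (by decide)))
  have h4 : ¬ ((0 : Fin 5) ∈ T ∧ (4 : Fin 5) ∈ T ∧ (2 : Fin 5) ∈ T) := fun ⟨h0, h3, h1⟩ =>
    hT 0 (((arc h0 h3 (by decide)).trans (arc h3 h1 (by decide))).trans (arc h1 h0 (by decide)))
  clear hT arc
  revert T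
  decide

theorem nineBounds_iff {R : Fin 5 → ℝ} : NineBounds R ↔ ∀ T ∈ nineSets,
    ∑ j ∈ T, R j ≤ (Finset.univ.filter fun k => (threeSenders.msgs k ∩ T).Nonempty).card := by
  have hcard : nineSets.map (fun T => (Finset.univ.filter fun k =>
    (threeSenders.msgs k ∩ T).Nonempty).card) = [2, 1, 3, 2, 2, 3, 3, 3, 3] := by decide
  simp only [nineSets, List.map_cons, List.map_nil, List.cons.injEq, and_true] at hcard
  obtain ⟨c0, c1, c2, c3, c4, c5, c6, c7, c8⟩ := hcard
  simp only [nineSets, List.forall_mem_cons, c0, c1, c2, c3, c4, c5, c6, c7, c8]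
  simp [NineBounds, add_assoc]

theorem nineStrictBounds_iff {R : Fin 5 → ℝ} : NineStrictBounds R ↔ ∀ T ∈ nineSets,
    ∑ j ∈ T, R j < (Finset.univ.filter fun k => (threeSenders.msgs k ∩ T).Nonempty).card := by
  have hcard : nineSets.map (fun T => (Finset.univ.filter fun k =>
    (threeSenders.msgs k ∩ T).Nonempty).card) = [2, 1, 3, 2, 2, 3, 3, 3, 3] := by decide
  simp only [nineSets, List.map_cons, List.map_nil, List.cons.injEq, and_true] at hcard
  obtain ⟨c0, c1, c2, c3, c4, c5, c6, c7, c8⟩ := hcard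
  simp only [nineSets, List.forall_mem_cons, c0, c1, c2, c3, c4, c5, c6, c7, c8]
  simp [NineStrictBounds, add_assoc]

theorem sum_cap_threeSenders (s : Finset (Fin 3)) : ∑ k ∈ s, threeSenders.cap k = s.card := by
  simp [threeSenders]

theorem maisRegion_threeSenders :
    threeSenders.maisRegion = {R : Fin 5 → ℝ | (∀ j, 0 ≤ R j) ∧ NineBounds R} := by
  ext R
  simp only [maisRegion, sum_cap_threeSenders, Set.mem_ofPred_eq, nineBounds_iff]
  refine and_congr_right fun h0 => ⟨fun h T hT => h T (acyclicOn_of_mem_nineSets hT),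
    fun h T hT => ?_⟩
  obtain ⟨F, hF, ⟨hTF, hc⟩ | rfl⟩ := exists_nineSets_superset hT
  · exact (Finset.sum_le_sum_of_subset_of_nonneg hTF fun j _ _ => h0 j).trans
      ((h F hF).trans (by exact_mod_cast hc))
  · simp

theorem NineBounds.nineStrictBounds_smul {R : Fin 5 → ℝ} (h : NineBounds R) {t : ℝ} (h0 : 0 ≤ t)
    (h1 : t < 1) : NineStrictBounds (t • R) := by
  obtain ⟨a, b, c, d, e, f, g, i, j⟩ := h
  have key : ∀ x y : ℝ, x ≤ y → 0 < y → t * x < y := fun x y hx hy => by nlinarith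
  simp only [NineStrictBounds, Pi.smul_apply, smul_eq_mul, ← mul_add]
  exact ⟨key _ _ a (by norm_num), key _ _ b (by norm_num), key _ _ c (by norm_num),
    key _ _ d (by norm_num), key _ _ e (by norm_num), key _ _ f (by norm_num),
    key _ _ g (by norm_num), key _ _ i (by norm_num), key _ _ j (by norm_num)⟩

/-- Every tuple with strict bounds is a scaled copy of a tuple of the closed region. -/
theorem NineStrictBounds.exists_smul {R : Fin 5 → ℝ} (h : NineStrictBounds R) :
    ∃ δ : ℝ, 0 < δ ∧ δ < 1 ∧ NineBounds ((1 - δ)⁻¹ • R) := by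
  have key : ∀ᶠ δ in 𝓝[>] (0 : ℝ), NineStrictBounds ((1 - δ)⁻¹ • R) := by
    have hlim : ∀ x y : ℝ, x < y → ∀ᶠ δ in 𝓝[>] (0 : ℝ), (1 - δ)⁻¹ * x < y := by
      intro x y hxy
      have : Tendsto (fun δ : ℝ => (1 - δ)⁻¹ * x) (𝓝[>] 0) (𝓝 ((1 - 0)⁻¹ * x)) := by
        refine Tendsto.mul_const _ (Tendsto.inv₀ ?_ (by norm_num))
        exact (tendsto_const_nhds.sub tendsto_id).mono_left nhdsWithin_le_nhds
      rw [sub_zero, inv_one, one_mul] at this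
      exact this.eventually_lt_const hxy
    simp only [NineStrictBounds, Pi.smul_apply, smul_eq_mul, ← mul_add]
    obtain ⟨a, b, c, d, e, f, g, i, j⟩ := h
    exact (hlim _ _ a).and ((hlim _ _ b).and ((hlim _ _ c).and ((hlim _ _ d).and
      ((hlim _ _ e).and ((hlim _ _ f).and ((hlim _ _ g).and ((hlim _ _ i).and
      (hlim _ _ j))))))))
  have h1 : ∀ᶠ δ in 𝓝[>] (0 : ℝ), δ < 1 :=
    mem_nhdsWithin_of_mem_nhds (Iio_mem_nhds one_pos)
  obtain ⟨δ, ⟨hδ, hδ1⟩, hδ0⟩ := ((key.and h1).and self_mem_nhdsWithin).exists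
  refine ⟨δ, hδ0, hδ1, ?_⟩
  obtain ⟨a, b, c, d, e, f, g, i, j⟩ := hδ
  exact ⟨a.le, b.le, c.le, d.le, e.le, f.le, g.le, i.le, j.le⟩

/-- All nine right-hand sides are positive, so shrinking a tuple towards the origin makes its
inequalities strict. -/
theorem closure_strict_eq :
    closure {R : Fin 5 → ℝ | (∀ j, 0 ≤ R j) ∧ NineStrictBounds R} = threeSenders.maisRegion := by
  refine Set.Subset.antisymm (closure_minimal ?_ threeSenders.isClosed_maisRegion) ?_
  · rw [maisRegion_threeSenders]
    rintro R ⟨h0, a, b, c, d, e, f, g, i, j⟩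
    exact ⟨h0, a.le, b.le, c.le, d.le, e.le, f.le, g.le, i.le, j.le⟩
  · rw [maisRegion_threeSenders]
    rintro R ⟨h0, h⟩
    have hlim : Tendsto (fun t : ℝ => t • R) (𝓝[<] 1) (𝓝 ((1 : ℝ) • R)) :=
      (tendsto_id.smul_const R).mono_left nhdsWithin_le_nhds
    rw [one_smul] at hlim
    refine mem_closure_of_tendsto hlim ?_
    have h1 : ∀ᶠ t in 𝓝[<] (1 : ℝ), 0 < t := mem_nhdsWithin_of_mem_nhds (Ioi_mem_nhds one_pos)
    filter_upwards [h1, self_mem_nhdsWithin] with t ht ht1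
    exact ⟨fun j => mul_nonneg ht.le (h0 j), h.nineStrictBounds_smul ht.le ht1⟩

theorem isGrouping_senderPairs : IsGrouping senderPairs := by
  constructor <;> decide

theorem cccRegion_senderPairs_subset : threeSenders.cccRegion senderPairs ⊆
    {R : Fin 5 → ℝ | (∀ j, 0 ≤ R j) ∧ NineStrictBounds R} := by
  intro R hR
  refine ⟨(cccRegion_subset_maisRegion _ isGrouping_senderPairs hR).1,
    nineStrictBounds_iff.2 fun T hT => ?_⟩
  rw [← sum_cap_threeSenders]
  refine sum_lt_of_mem_cccRegion isGrouping_senderPairs hR (acyclicOn_of_mem_nineSets hT) ?_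
  revert T
  decide

/-! ### Elementary modes and composite coding in pairs of senders. -/

/-- The messages that receive one bit each in the ten elementary transmission modes. -/
def modeMsgs : Fin 10 → Finset (Fin 5) :=
  ![{4}, {1}, {0, 1, 2, 3}, {3}, {0, 1, 2, 3}, {1, 2}, {0, 2, 4}, {1, 2}, {0, 1, 2, 3}, {0}]

/-- The senders that spend one bit each in the ten elementary transmission modes. -/
def modeSenders : Fin 10 → Finset (Fin 3) :=
  ![{2}, {2}, {0, 1}, {1}, {0, 2}, {1}, {0, 2}, {0}, {1, 2}, {0}]

/-- The back-substitution step of Fourier–Motzkin elimination: a value for one variable exists once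
every lower bound is below every upper bound. -/
theorem exists_between_lists {L U : List ℝ} (h : ∀ l ∈ L, ∀ u ∈ U, l ≤ u) :
    ∃ x, (∀ l ∈ L, l ≤ x) ∧ ∀ u ∈ U, x ≤ u := by
  have hL : BddAbove {l | l ∈ L} := L.finite_toSet.bddAbove
  have hU : BddBelow {u | u ∈ U} := U.finite_toSet.bddBelow
  rcases L.eq_nil_or_concat with rfl | ⟨_, l, rfl⟩
  · obtain ⟨x, hx⟩ := hU
    exact ⟨x, by simp, fun u hu => hx hu⟩
  · exact ⟨sSup {x | x ∈ _}, fun l hl => le_csSup hL hl,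
      fun u hu => csSup_le ⟨l, by simp⟩ fun l hl => h l hl u hu⟩

/-- Every tuple that satisfies the nine bounds is dominated by a mixture of elementary modes that
respects the capacities; the weights are found by Fourier-Motzkin elimination. -/
theorem NineBounds.exists_weights {R : Fin 5 → ℝ} (h0 : ∀ j, 0 ≤ R j) (h : NineBounds R) :
    ∃ μ : Fin 10 → ℝ, (∀ m, 0 ≤ μ m) ∧ (∀ k, ∑ m with k ∈ modeSenders m, μ m ≤ 1) ∧
      ∀ j, R j ≤ ∑ m with j ∈ modeMsgs m, μ m := by
  obtain ⟨h₁, h₂, h₃, h₄, h₅, h₆, h₇, h₈, h₉⟩ := h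
  have p0 := h0 0
  have p1 := h0 1
  have p2 := h0 2
  have p3 := h0 3
  have p4 := h0 4
  -- The weights are chosen in the reverse of the elimination order. Each list holds bounds in terms
  -- of `R` and earlier weights, including the consequences of solvability for the later ones.
  obtain ⟨x8, lx8, ux8⟩ := exists_between_lists (L := [0, R 0 - 1])
    (U := [3 - R 1 - R 4, 2 - R 3 - R 4, 1 - R 4])
    (by simp only [List.forall_mem_cons, List.not_mem_nil, false_imp_iff, implies_true, and_true]
        constructorm* _ ∧ _ <;> linarith)
  simp only [List.forall_mem_cons, List.not_mem_nil, false_imp_iff, implies_true, and_true]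
    at lx8 ux8
  obtain ⟨x5, lx5, ux5⟩ := exists_between_lists (L := [0, R 1 + R 4 - 2, R 2 - x8 - 1])
    (U := [2 - R 3 - R 4 - x8, 1 - x8])
    (by simp only [List.forall_mem_cons, List.not_mem_nil, false_imp_iff, implies_true, and_true]
        constructorm* _ ∧ _ <;> linarith)
  simp only [List.forall_mem_cons, List.not_mem_nil, false_imp_iff, implies_true, and_true]
    at lx5 ux5
  obtain ⟨x1, lx1, ux1⟩ := exists_between_lists (L := [0, R 1 - x5 - x8 - 1])
    (U := [2 - R 3 - R 4 - x5 - x8, 3 - R 0 - R 2, 1 - R 4 - x8])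
    (by simp only [List.forall_mem_cons, List.not_mem_nil, false_imp_iff, implies_true, and_true]
        constructorm* _ ∧ _ <;> linarith)
  simp only [List.forall_mem_cons, List.not_mem_nil, false_imp_iff, implies_true, and_true]
    at lx1 ux1
  obtain ⟨x4, lx4, ux4⟩ := exists_between_lists (L := [0, R 0 + R 1 - x1 - x8 - 2, R 3 + x5 - 1])
    (U := [1 - R 4 - x1 - x8])
    (by simp only [List.forall_mem_cons, List.not_mem_nil, false_imp_iff, implies_true, and_true]
        constructorm* _ ∧ _ <;> linarith)
  simp only [List.forall_mem_cons, List.not_mem_nil, false_imp_iff, implies_true, and_true]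
    at lx4 ux4
  obtain ⟨x6, lx6, ux6⟩ := exists_between_lists (L := [0, R 0 + R 2 - x4 - x8 - 2])
    (U := [x1 + x5 + x8 - R 1 + 1, 1 - x1 - x4 - x8])
    (by simp only [List.forall_mem_cons, List.not_mem_nil, false_imp_iff, implies_true, and_true]
        constructorm* _ ∧ _ <;> linarith)
  simp only [List.forall_mem_cons, List.not_mem_nil, false_imp_iff, implies_true, and_true]
    at lx6 ux6
  obtain ⟨x9, lx9, ux9⟩ := exists_between_lists (L := [0, R 0 + x5 - x4 - x6 - 1])
    (U := [x1 + x5 + x8 - R 1 - x6 + 1, x5 + x8 - R 2 + 1, 1 - x4 - x6])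
    (by simp only [List.forall_mem_cons, List.not_mem_nil, false_imp_iff, implies_true, and_true]
        constructorm* _ ∧ _ <;> linarith)
  simp only [List.forall_mem_cons, List.not_mem_nil, false_imp_iff, implies_true, and_true]
    at lx9 ux9
  obtain ⟨x2, lx2, ux2⟩ := exists_between_lists (L := [0, R 0 - x4 - x6 - x8 - x9])
    (U := [1 - x4 - x6 - x9, 1 - x5 - x8])
    (by simp only [List.forall_mem_cons, List.not_mem_nil, false_imp_iff, implies_true, and_true]
        constructorm* _ ∧ _ <;> linarith)
  simp only [List.forall_mem_cons, List.not_mem_nil, false_imp_iff, implies_true, and_true]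
    at lx2 ux2
  obtain ⟨x7, lx7, ux7⟩ := exists_between_lists (L := [0, R 1 - x1 - x2 - x4 - x5 - x8,
      R 2 - x2 - x4 - x5 - x6 - x8])
    (U := [1 - x2 - x4 - x6 - x9])
    (by simp only [List.forall_mem_cons, List.not_mem_nil, false_imp_iff, implies_true, and_true]
        constructorm* _ ∧ _ <;> linarith)
  simp only [List.forall_mem_cons, List.not_mem_nil, false_imp_iff, implies_true, and_true]
    at lx7 ux7
  obtain ⟨x3, lx3, ux3⟩ := exists_between_lists (L := [0, R 3 - x2 - x4 - x8])
    (U := [1 - x2 - x5 - x8])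
    (by simp only [List.forall_mem_cons, List.not_mem_nil, false_imp_iff, implies_true, and_true]
        constructorm* _ ∧ _ <;> linarith)
  simp only [List.forall_mem_cons, List.not_mem_nil, false_imp_iff, implies_true, and_true]
    at lx3 ux3
  obtain ⟨x0, lx0, ux0⟩ := exists_between_lists (L := [0, R 4 - x6])
    (U := [1 - x1 - x4 - x6 - x8])
    (by simp only [List.forall_mem_cons, List.not_mem_nil, false_imp_iff, implies_true, and_true]
        constructorm* _ ∧ _ <;> linarith)
  simp only [List.forall_mem_cons, List.not_mem_nil, false_imp_iff, implies_true, and_true]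
    at lx0 ux0
  refine ⟨![x0, x1, x2, x3, x4, x5, x6, x7, x8, x9], ?_, ?_, ?_⟩
  · simp [Fin.forall_fin_succ, lx0.1, lx1.1, lx2.1, lx3.1, lx4.1, lx5.1, lx6.1, lx7.1, lx8.1, lx9.1]
  · simp only [Finset.sum_filter]
    simp [Fin.forall_fin_succ, Fin.sum_univ_succ, modeSenders]
    constructorm* _ ∧ _ <;> linarith
  · simp only [Finset.sum_filter]
    simp [Fin.forall_fin_succ, Fin.sum_univ_succ, modeMsgs]
    constructorm* _ ∧ _ <;> linarith

namespace Problem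

variable {K N : ℕ}

/-- Double counting reduces inequalities between mixtures to comparisons of cardinalities, one mode
at a time. -/
theorem sum_sum_filter_mem {α ι : Type*} [DecidableEq α] (S : Finset α) (s : Finset ι)
    (A : ι → Finset α) (μ : ι → ℝ) :
    ∑ a ∈ S, ∑ m ∈ s with a ∈ A m, μ m = ∑ m ∈ s, μ m * (S ∩ A m).card := by
  simp_rw [Finset.sum_filter]
  rw [Finset.sum_comm]
  refine Finset.sum_congr rfl fun m _ => ?_
  rw [← Finset.sum_filter, Finset.sum_const, nsmul_eq_mul, mul_comm, Finset.filter_mem_eq_inter]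

/-- Cooperative composite coding by a mixture of elementary modes: the mode `m` serves the messages
`A m` with one bit each, uses the composite messages `Γ m` and loads the senders `B m`. -/
theorem mem_cccGroupRegionAt_of_modes {p : Problem K N} {P : Finset (Fin K)} {c : Fin K → ℝ}
    {D : Fin N → Finset (Fin N)} {r : Fin N → ℝ} {ι : Type*} (s : Finset ι)
    {A : ι → Finset (Fin N)} {B : ι → Finset (Fin K)} {Γ : ι → Finset (Finset (Fin N))}
    {μ : ι → ℝ} {η : ℝ} (hD : p.IsDecodingChoice P D) (hμ : ∀ m, 0 ≤ μ m) (hη : 0 < η)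
    (hr0 : ∀ j, 0 ≤ r j) (hr : ∀ j, r j ≤ ∑ m ∈ s with j ∈ A m, μ m)
    (hc : ∀ k, ∑ m ∈ s with k ∈ B m, μ m + η ≤ c k)
    (hdec : ∀ m ∈ s, ∀ j ∈ p.groupMsgs P, ∀ T ⊆ D j, (T ∩ A m).card ≤
      ((p.composites P).filter (fun J => J ⊆ D j ∪ p.groupSide P j ∧ (J ∩ T).Nonempty) ∩
        Γ m).card)
    (hcap : ∀ m ∈ s, ∀ j ∈ p.groupMsgs P, ∀ Q ⊆ P,
      ((p.composites Q).filter (fun J => J ∉ p.composites (P \ Q) ∧ ¬ J ⊆ p.groupSide P j) ∩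
        Γ m).card ≤ (Q ∩ B m).card) :
    r ∈ p.cccGroupRegionAt P c D := by
  set M : ℝ := (Fintype.card (Finset (Fin N)) : ℝ)
  have hM0 : 0 ≤ M := Nat.cast_nonneg _
  -- Every composite receives the extra rate `η / (M + 1)`. This makes decoding strict, while at
  -- most `M` composites load a sender set, so the extra load stays below the reserve `η`.
  have hε : 0 < η / (M + 1) := by positivity
  refine ⟨fun j _ => hr0 j, fun J => ∑ m ∈ s with J ∈ Γ m, μ m + η / (M + 1), fun J _ => ?_,
    fun j hj T hT hne => ?_, fun j hj Q hQP hQ => ?_⟩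
  · exact add_nonneg (Finset.sum_nonneg fun m _ => hμ m) hε.le
  · calc ∑ i ∈ T, r i ≤ ∑ i ∈ T, ∑ m ∈ s with i ∈ A m, μ m :=
          Finset.sum_le_sum fun i _ => hr i
      _ = ∑ m ∈ s, μ m * (T ∩ A m).card := sum_sum_filter_mem ..
      _ ≤ ∑ m ∈ s, μ m * (((p.composites P).filter
            (fun J => J ⊆ D j ∪ p.groupSide P j ∧ (J ∩ T).Nonempty) ∩ Γ m).card : ℝ) :=
          Finset.sum_le_sum fun m hm => mul_le_mul_of_nonneg_left
            (by exact_mod_cast hdec m hm j hj T hT) (hμ m)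
      _ = _ := (sum_sum_filter_mem ..).symm
      _ < _ := by
          obtain ⟨i, hi⟩ := hne
          -- The singleton of any `i ∈ T` is a usable composite, so some extra rate is really
          -- present.
          refine Finset.sum_lt_sum_of_nonempty ⟨{i}, ?_⟩ fun J _ => lt_add_of_pos_right _ hε
          have hiD := hT hi
          obtain ⟨k, hk, hik⟩ := mem_groupMsgs.1 (Finset.mem_sdiff.1 ((hD j hj).2 hiD)).1
          simp only [Finset.mem_filter, mem_composites, Finset.singleton_subset_iff]
          exact ⟨⟨k, hk, hik⟩, Finset.mem_union_left _ hiD, i, by simp [hi]⟩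
  · set S := (p.composites Q).filter
      (fun J => J ∉ p.composites (P \ Q) ∧ ¬ J ⊆ p.groupSide P j)
    have hcard : (S.card : ℝ) * (η / (M + 1)) < η := by
      have h1 : (S.card : ℝ) ≤ M := Nat.cast_le.2 (Finset.card_le_univ S)
      rw [← mul_div_assoc, div_lt_iff₀ (by positivity), mul_comm]
      exact mul_lt_mul_of_pos_left (by linarith) hη
    have hQc : η ≤ Q.card * η := by
      have : (1 : ℝ) ≤ Q.card := by exact_mod_cast hQ.card_pos
      nlinarith
    rw [Finset.sum_add_distrib, sum_sum_filter_mem, Finset.sum_const, nsmul_eq_mul]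
    calc _ < ∑ m ∈ s, μ m * ((S ∩ Γ m).card : ℝ) + Q.card * η := by linarith
      _ ≤ ∑ m ∈ s, μ m * ((Q ∩ B m).card : ℝ) + Q.card * η :=
          add_le_add_left (Finset.sum_le_sum fun m hm => mul_le_mul_of_nonneg_left
            (by exact_mod_cast hcap m hm j hj Q hQP) (hμ m)) _
      _ = ∑ k ∈ Q, (∑ m ∈ s with k ∈ B m, μ m + η) := by
          rw [Finset.sum_add_distrib, sum_sum_filter_mem, Finset.sum_const, nsmul_eq_mul]
      _ ≤ _ := Finset.sum_le_sum fun k _ => hc k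

end Problem

/-- The sender pair used by each elementary mode. -/
def modeGroup : Fin 10 → Finset (Fin 3) :=
  ![{1, 2}, {1, 2}, {0, 1}, {0, 1}, {0, 2}, {0, 1}, {0, 2}, {0, 1}, {1, 2}, {0, 1}]

/-- The composite messages sent in each elementary mode. -/
def modeComposites : Fin 10 → Finset (Finset (Fin 5)) :=
  ![{{4}}, {{0, 1}}, {{0}, {1, 2}, {3}}, {{1, 3}}, {{0, 1, 2}, {0, 3}}, {{1, 2, 3}},
    {{0}, {2}, {4}}, {{0, 1, 2}}, {{1, 2, 3}, {0, 3}}, {{0}}]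

/-- The messages decoded by each receiver from each sender pair. -/
def pairDecoding (P : Finset (Fin 3)) : Fin 5 → Finset (Fin 5) :=
  if P = {0, 1} then ![{0}, {1, 3}, {2, 3}, {3}, ∅]
  else if P = {1, 2} then ![{0}, {1, 3}, {2, 3}, {0, 3}, {4}]
  else ![{0}, {1}, {2, 3, 4}, {0, 3}, {4}]

theorem isDecodingChoice_pairDecoding :
    ∀ P ∈ senderPairs, threeSenders.IsDecodingChoice P (pairDecoding P) := by
  unfold Problem.IsDecodingChoice
  decide +kernel

theorem modes_decodable : ∀ m, ∀ j ∈ threeSenders.groupMsgs (modeGroup m),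
    ∀ T ⊆ pairDecoding (modeGroup m) j, (T ∩ modeMsgs m).card ≤
      ((threeSenders.composites (modeGroup m)).filter (fun J =>
        J ⊆ pairDecoding (modeGroup m) j ∪ threeSenders.groupSide (modeGroup m) j ∧
          (J ∩ T).Nonempty) ∩ modeComposites m).card := by
  decide +kernel

/-- A mode may use more composites than senders, since a receiver is not charged for those it knows.
Mode 2 uses `{0}`, `{1, 2}`, `{3}` on two links, and each of the four receivers in the group knows
one of them. -/
theorem modes_load_le : ∀ m, ∀ j ∈ threeSenders.groupMsgs (modeGroup m), ∀ Q ⊆ modeGroup m,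
    ((threeSenders.composites Q).filter (fun J => J ∉ threeSenders.composites (modeGroup m \ Q) ∧
      ¬ J ⊆ threeSenders.groupSide (modeGroup m) j) ∩ modeComposites m).card ≤
        (Q ∩ modeSenders m).card := by
  decide +kernel

theorem modeMsgs_subset : ∀ m, modeMsgs m ⊆ threeSenders.groupMsgs (modeGroup m) := by
  decide +kernel

theorem modeGroup_mem : ∀ m, modeGroup m ∈ senderPairs := by decide +kernel

theorem strict_subset_cccRegion_senderPairs {R : Fin 5 → ℝ} (h0 : ∀ j, 0 ≤ R j)
    (h : NineStrictBounds R) : R ∈ threeSenders.cccRegion senderPairs := by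
  -- Weights for `R / (1 - δ)`, scaled back by `1 - δ`, carry `R` and leave capacity `δ` on every
  -- link.
  obtain ⟨δ, hδ0, hδ1, hδ⟩ := h.exists_smul
  have ht : 0 < 1 - δ := sub_pos.2 hδ1
  obtain ⟨ν, hν, hload, hrate⟩ := hδ.exists_weights fun j =>
    mul_nonneg (inv_nonneg.2 ht.le) (h0 j)
  let μ : Fin 10 → ℝ := fun m => (1 - δ) * ν m
  have hμ : ∀ m, 0 ≤ μ m := fun m => mul_nonneg ht.le (hν m)
  have hload' : ∀ k, ∑ m with k ∈ modeSenders m, μ m ≤ 1 - δ := fun k => by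
    rw [← Finset.mul_sum]
    exact mul_le_of_le_one_right ht.le (hload k)
  have hrate' : ∀ j, R j ≤ ∑ m with j ∈ modeMsgs m, μ m := fun j => by
    rw [← Finset.mul_sum, ← div_le_iff₀' ht, div_eq_inv_mul]
    exact hrate j
  -- the modes that use the pair `P`, and the part of the rates that they carry
  let s : Finset (Fin 3) → Finset (Fin 10) := fun P => Finset.univ.filter fun m => modeGroup m = P
  let a : Finset (Fin 3) → Fin 5 → ℝ := fun P j => ∑ m ∈ s P with j ∈ modeMsgs m, μ m
  have split : ∀ q : Fin 10 → Prop, ∀ _ : DecidablePred q,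
      ∑ P ∈ senderPairs, ∑ m ∈ s P with q m, μ m = ∑ m with q m, μ m := by
    intro q _
    rw [← Finset.sum_fiberwise_of_maps_to (t := senderPairs) (g := modeGroup)
      fun m _ => modeGroup_mem m]
    refine Finset.sum_congr rfl fun P _ => Finset.sum_congr ?_ fun _ _ => rfl
    ext m
    simp [s, and_comm]
  have ha0 : ∀ P j, 0 ≤ a P j := fun P j => Finset.sum_nonneg fun m _ => hμ m
  have ha : ∀ j, ∑ P ∈ senderPairs, a P j = ∑ m with j ∈ modeMsgs m, μ m := fun j => split _ _
  -- The carried rates may exceed `R j`, so they are scaled down proportionally. If nothing is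
  -- carried then `R j = 0`, in agreement with division by zero.
  let r : Finset (Fin 3) → Fin 5 → ℝ := fun P j => R j / (∑ m with j ∈ modeMsgs m, μ m) * a P j
  -- Each sender lies in two pairs, so its reserve `δ` is halved.
  let c : Finset (Fin 3) → Fin 3 → ℝ := fun P k => ∑ m ∈ s P with k ∈ modeSenders m, μ m + δ / 2
  have hc : threeSenders.IsLinkSplit senderPairs c := by
    refine ⟨fun P _ k _ => add_pos_of_nonneg_of_pos (Finset.sum_nonneg fun m _ => hμ m)
      (half_pos hδ0), fun k => ?_⟩
    have hcard : (senderPairs.filter fun P => k ∈ P).card = 2 := by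
      revert k
      decide
    have hle : ∑ P ∈ senderPairs with k ∈ P, ∑ m ∈ s P with k ∈ modeSenders m, μ m ≤
        ∑ P ∈ senderPairs, ∑ m ∈ s P with k ∈ modeSenders m, μ m :=
      Finset.sum_le_sum_of_subset_of_nonneg (Finset.filter_subset _ _) fun P _ _ =>
        Finset.sum_nonneg fun m _ => hμ m
    rw [split] at hle
    rw [Finset.sum_add_distrib, Finset.sum_const, hcard, nsmul_eq_mul]
    have := hload' k
    simp only [threeSenders, Nat.cast_ofNat]
    linarith
  refine Set.mem_iUnion₂.2 ⟨c, hc, r, fun P hP => Set.mem_iUnion₂.2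
    ⟨_, isDecodingChoice_pairDecoding P hP, ?_⟩, fun j => ?_⟩
  · refine mem_cccGroupRegionAt_of_modes (s P) (A := modeMsgs) (B := modeSenders)
      (Γ := modeComposites) (isDecodingChoice_pairDecoding P hP) hμ (half_pos hδ0)
      (fun j => mul_nonneg (div_nonneg (h0 j) ((h0 j).trans (hrate' j))) (ha0 P j))
      (fun j => mul_le_of_le_one_left (ha0 P j)
        (div_le_one_of_le₀ (hrate' j) ((h0 j).trans (hrate' j))))
      (fun k => le_rfl) ?_ ?_
    · intro m hm
      obtain rfl := (Finset.mem_filter.1 hm).2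
      exact modes_decodable m
    · intro m hm
      obtain rfl := (Finset.mem_filter.1 hm).2
      exact modes_load_le m
  · have hzero : ∑ P ∈ senderPairs with j ∈ threeSenders.groupMsgs P, a P j =
        ∑ P ∈ senderPairs, a P j := by
      refine Finset.sum_filter_of_ne fun P _ hne => ?_
      obtain ⟨m, hm, -⟩ := Finset.exists_ne_zero_of_sum_ne_zero hne
      obtain ⟨hm, hj⟩ := Finset.mem_filter.1 hm
      exact (Finset.mem_filter.1 hm).2 ▸ modeMsgs_subset m hj
    rw [← Finset.mul_sum, hzero, ha]
    rcases eq_or_ne (∑ m with j ∈ modeMsgs m, μ m) 0 with h | h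
    · rw [h, mul_zero]
      exact le_antisymm (h ▸ hrate' j) (h0 j)
    · rw [div_mul_cancel₀ _ h]

theorem cccRegion_senderPairs : threeSenders.cccRegion senderPairs =
    {R : Fin 5 → ℝ | (∀ j, 0 ≤ R j) ∧ NineStrictBounds R} :=
  cccRegion_senderPairs_subset.antisymm fun _ h => strict_subset_cccRegion_senderPairs h.1 h.2

theorem closure_cccRegion_senderPairs :
    closure (threeSenders.cccRegion senderPairs) = threeSenders.maisRegion := by
  rw [cccRegion_senderPairs, closure_strict_eq]

theorem cccRegion_senderPairs_subset_regionCLS :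
    threeSenders.cccRegion senderPairs ⊆ threeSenders.regionCLS :=
  (Set.subset_iUnion₂ (s := fun Gs (_ : Gs ∈ {Gs | IsGrouping Gs}) => threeSenders.cccRegion Gs)
    senderPairs isGrouping_senderPairs).trans (subset_convexHull ℝ _)

theorem closure_regionCLS : closure threeSenders.regionCLS = threeSenders.maisRegion := by
  refine (closure_minimal threeSenders.regionCLS_subset_maisRegion
    threeSenders.isClosed_maisRegion).antisymm ?_
  rw [← closure_cccRegion_senderPairs]
  exact closure_mono cccRegion_senderPairs_subset_regionCLS

/-! ### Duality certificates. -/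

/-- A certificate for a linear bound on the rates of composite coding that is valid for all
decoding choices between `lower` and `upper`: lists of the receivers and message sets of the
decoding conditions to be added up, and of the receivers and sender sets of the load conditions. -/
structure BoundCertificate (K N : ℕ) where
  lower : Fin N → Finset (Fin N)
  upper : Fin N → Finset (Fin N)
  decoders : List (Fin N × Finset (Fin N))
  loads : List (Fin N × Finset (Fin K))

namespace Problem

variable {K N : ℕ}

theorem sum_countP_mul {α β : Type*} (S : Finset α) (f : α → ℝ) (U : List β)
    (q : α → β → Prop) [∀ a b, Decidable (q a b)] :
    ∑ a ∈ S, (U.countP fun u => q a u : ℝ) * f a = (U.map fun u => ∑ a ∈ S with q a u,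
      f a).sum := by
  induction U with
  | nil => simp
  | cons u U ih =>
    rw [List.map_cons, List.sum_cons, ← ih, Finset.sum_filter, ← Finset.sum_add_distrib]
    refine Finset.sum_congr rfl fun a _ => ?_
    by_cases h : q a u <;> simp [h, add_mul, add_comm]

/-- Weak duality: the listed decoding and load conditions are added with multiplicity, and
nonnegativity of `r` and `γ` allows comparison coefficient by coefficient. One certificate serves a
whole range of `D`: `lower` makes the decoding conditions applicable, and `upper` overestimates the
composites they can use. -/
theorem sum_mul_le_of_certificate {p : Problem K N} {P : Finset (Fin K)} {c : Fin K → ℝ}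
    {D : Fin N → Finset (Fin N)} {r : Fin N → ℝ} (hr : r ∈ p.cccGroupRegionAt P c D)
    (hD : p.IsDecodingChoice P D) {w : Fin N → ℕ} (C : BoundCertificate K N)
    (hU : ∀ u ∈ C.decoders, u.1 ∈ p.groupMsgs P ∧ u.2 ⊆ C.lower u.1 ∧ u.2.Nonempty)
    (hlow : ∀ u ∈ C.decoders, C.lower u.1 ⊆ D u.1) (hup : ∀ u ∈ C.decoders, D u.1 ⊆ C.upper u.1)
    (hV : ∀ v ∈ C.loads, v.1 ∈ p.groupMsgs P ∧ v.2 ⊆ P ∧ v.2.Nonempty)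
    (hw : ∀ i ∈ p.groupMsgs P, w i ≤ C.decoders.countP fun u => i ∈ u.2)
    (hJ : ∀ J ∈ p.composites P,
      (C.decoders.countP fun u => J ⊆ C.upper u.1 ∪ p.groupSide P u.1 ∧ (J ∩ u.2).Nonempty) ≤
        C.loads.countP fun v => J ∈ p.composites v.2 ∧ J ∉ p.composites (P \ v.2) ∧
          ¬ J ⊆ p.groupSide P v.1) :
    ∑ i ∈ p.groupMsgs P, (w i : ℝ) * r i ≤ (C.loads.map fun v => ∑ k ∈ v.2, c k).sum := by
  obtain ⟨h0, γ, hγ, hdec, hcap⟩ := hr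
  calc ∑ i ∈ p.groupMsgs P, (w i : ℝ) * r i
      ≤ ∑ i ∈ p.groupMsgs P, (C.decoders.countP fun u => i ∈ u.2 : ℝ) * r i :=
        Finset.sum_le_sum fun i hi =>
          mul_le_mul_of_nonneg_right (by exact_mod_cast hw i hi) (h0 i hi)
    _ = (C.decoders.map fun u => ∑ i ∈ p.groupMsgs P with i ∈ u.2, r i).sum :=
        sum_countP_mul _ _ _ _
    _ ≤ (C.decoders.map fun u => ∑ J ∈ p.composites P with
          J ⊆ C.upper u.1 ∪ p.groupSide P u.1 ∧ (J ∩ u.2).Nonempty, γ J).sum := by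
        refine List.sum_le_sum fun u hu => ?_
        obtain ⟨h1, h2, h3⟩ := hU u hu
        have hT := h2.trans (hlow u hu)
        have hsub : (p.groupMsgs P).filter (fun i => i ∈ u.2) = u.2 := by
          rw [Finset.filter_mem_eq_inter, Finset.inter_eq_right]
          exact hT.trans ((hD u.1 h1).2.trans Finset.sdiff_subset)
        rw [hsub]
        refine (hdec u.1 h1 u.2 hT h3).le.trans
          (Finset.sum_le_sum_of_subset_of_nonneg (fun J hJ => ?_) fun J hJ _ =>
            hγ J (Finset.mem_filter.1 hJ).1)
        obtain ⟨a, b, d⟩ := Finset.mem_filter.1 hJ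
        exact Finset.mem_filter.2
          ⟨a, b.trans (Finset.union_subset_union (hup u hu) subset_rfl), d⟩
    _ = ∑ J ∈ p.composites P, (C.decoders.countP fun u =>
          J ⊆ C.upper u.1 ∪ p.groupSide P u.1 ∧ (J ∩ u.2).Nonempty : ℝ) * γ J :=
        (sum_countP_mul _ _ _ _).symm
    _ ≤ ∑ J ∈ p.composites P, (C.loads.countP fun v => J ∈ p.composites v.2 ∧
          J ∉ p.composites (P \ v.2) ∧ ¬ J ⊆ p.groupSide P v.1 : ℝ) * γ J :=
        Finset.sum_le_sum fun J hJP =>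
          mul_le_mul_of_nonneg_right (by exact_mod_cast hJ J hJP) (hγ J hJP)
    _ = (C.loads.map fun v => ∑ J ∈ p.composites P with J ∈ p.composites v.2 ∧
          J ∉ p.composites (P \ v.2) ∧ ¬ J ⊆ p.groupSide P v.1, γ J).sum :=
        sum_countP_mul _ _ _ _
    _ ≤ _ := by
        refine List.sum_le_sum fun v hv => ?_
        obtain ⟨h1, h2, h3⟩ := hV v hv
        refine le_trans (le_of_eq (Finset.sum_congr ?_ fun _ _ => rfl)) (hcap v.1 h1 v.2 h2 h3).le
        ext J
        simp only [Finset.mem_filter]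
        exact ⟨fun h => h.2, fun h => ⟨p.composites_mono h2 h.1, h⟩⟩

/-- The analogue of `sum_mul_le_of_certificate` without cooperative compression; here the loads
are those of single senders. -/
theorem sum_mul_le_of_certificate_dcc {p : Problem K N} {P : Finset (Fin K)} {c : Fin K → ℝ}
    {D : Fin N → Finset (Fin N)} {r : Fin N → ℝ} (hr : r ∈ p.dccGroupRegionAt P c D)
    (hD : p.IsDecodingChoice P D) {w : Fin N → ℕ} (C : BoundCertificate K N)
    (V : List (Fin N × Fin K))
    (hU : ∀ u ∈ C.decoders, u.1 ∈ p.groupMsgs P ∧ u.2 ⊆ C.lower u.1 ∧ u.2.Nonempty)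
    (hlow : ∀ u ∈ C.decoders, C.lower u.1 ⊆ D u.1) (hup : ∀ u ∈ C.decoders, D u.1 ⊆ C.upper u.1)
    (hV : ∀ v ∈ V, v.1 ∈ p.groupMsgs P)
    (hw : ∀ i ∈ p.groupMsgs P, w i ≤ C.decoders.countP fun u => i ∈ u.2)
    (hJ : ∀ k ∈ P, ∀ J ⊆ p.msgs k,
      (C.decoders.countP fun u => J ⊆ C.upper u.1 ∪ p.groupSide P u.1 ∧ (J ∩ u.2).Nonempty) ≤
        V.countP fun v => v.2 = k ∧ ¬ J ⊆ p.groupSide P v.1) :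
    ∑ i ∈ p.groupMsgs P, (w i : ℝ) * r i ≤ ∑ k ∈ P, (V.countP fun v => v.2 = k : ℝ) * c k := by
  obtain ⟨h0, γ, hγ, hdec, hcap⟩ := hr
  -- pairs of a sender and one of its composite messages
  let S : Finset (Σ _ : Fin K, Finset (Fin N)) := P.sigma fun k => (p.msgs k).powerset
  have hS : ∀ x, x ∈ S ↔ x.1 ∈ P ∧ x.2 ⊆ p.msgs x.1 := fun x => by simp [S]
  have hγS : ∀ x ∈ S, 0 ≤ γ x.1 x.2 := fun x hx => hγ _ ((hS x).1 hx).1 _ ((hS x).1 hx).2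
  calc ∑ i ∈ p.groupMsgs P, (w i : ℝ) * r i
      ≤ ∑ i ∈ p.groupMsgs P, (C.decoders.countP fun u => i ∈ u.2 : ℝ) * r i :=
        Finset.sum_le_sum fun i hi =>
          mul_le_mul_of_nonneg_right (by exact_mod_cast hw i hi) (h0 i hi)
    _ = (C.decoders.map fun u => ∑ i ∈ p.groupMsgs P with i ∈ u.2, r i).sum :=
        sum_countP_mul _ _ _ _
    _ ≤ (C.decoders.map fun u => ∑ x ∈ S with
          x.2 ⊆ C.upper u.1 ∪ p.groupSide P u.1 ∧ (x.2 ∩ u.2).Nonempty, γ x.1 x.2).sum := by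
        refine List.sum_le_sum fun u hu => ?_
        obtain ⟨h1, h2, h3⟩ := hU u hu
        have hT := h2.trans (hlow u hu)
        have hsub : (p.groupMsgs P).filter (fun i => i ∈ u.2) = u.2 := by
          rw [Finset.filter_mem_eq_inter, Finset.inter_eq_right]
          exact hT.trans ((hD u.1 h1).2.trans Finset.sdiff_subset)
        rw [hsub]
        refine (hdec u.1 h1 u.2 hT h3).le.trans ?_
        rw [Finset.sum_sigma']
        refine (Finset.sum_bij_ne_zero (t := S.filter fun x => x.2 ⊆ D u.1 ∪ p.groupSide P u.1 ∧
          (x.2 ∩ u.2).Nonempty) (g := fun x => γ x.1 x.2) (fun x _ _ => ⟨x.2,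
            x.1⟩) ?_ ?_ ?_ ?_).le.trans
          (Finset.sum_le_sum_of_subset_of_nonneg (fun x hx => ?_) fun x hx _ =>
            hγS x (Finset.mem_filter.1 hx).1)
        · intro x hx _
          simp only [Finset.mem_sigma, Finset.mem_filter, Finset.mem_powerset, hS] at hx ⊢
          tauto
        · rintro ⟨a, b⟩ _ _ ⟨a', b'⟩ _ _ h
          simp only [Sigma.mk.injEq, heq_eq_eq] at h ⊢
          exact h.symm
        · rintro ⟨a, b⟩ hx hne
          simp only [Finset.mem_filter, hS] at hx
          refine ⟨⟨b, a⟩, ?_, hne, rfl⟩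
          simp only [Finset.mem_sigma, Finset.mem_filter, Finset.mem_powerset]
          tauto
        · exact fun _ _ _ => rfl
        · obtain ⟨a, b, d⟩ := Finset.mem_filter.1 hx
          exact Finset.mem_filter.2
            ⟨a, b.trans (Finset.union_subset_union (hup u hu) subset_rfl), d⟩
    _ = ∑ x ∈ S, (C.decoders.countP fun u =>
          x.2 ⊆ C.upper u.1 ∪ p.groupSide P u.1 ∧ (x.2 ∩ u.2).Nonempty : ℝ) * γ x.1 x.2 :=
        (sum_countP_mul _ _ _ _).symm
    _ ≤ ∑ x ∈ S, (V.countP fun v => v.2 = x.1 ∧ ¬ x.2 ⊆ p.groupSide P v.1 : ℝ) * γ x.1 x.2 :=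
        Finset.sum_le_sum fun x hx => mul_le_mul_of_nonneg_right
          (by exact_mod_cast hJ x.1 ((hS x).1 hx).1 x.2 ((hS x).1 hx).2) (hγS x hx)
    _ = (V.map fun v => ∑ x ∈ S with v.2 = x.1 ∧ ¬ x.2 ⊆ p.groupSide P v.1, γ x.1 x.2).sum :=
        sum_countP_mul _ _ _ _
    _ ≤ (V.map fun v => ∑ k ∈ P with v.2 = k, c k).sum := by
        refine List.sum_le_sum fun v hv => ?_
        rw [Finset.sum_filter, Finset.sum_sigma, Finset.sum_filter]
        refine Finset.sum_le_sum fun k hk => ?_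
        by_cases hvk : v.2 = k
        · simp only [hvk, true_and, if_true]
          rw [← Finset.sum_filter]
          exact (hcap v.1 (hV v hv) k hk).le
        · simp [hvk]
    _ = _ := (sum_countP_mul _ _ _ _).symm

end Problem

/-- A bound for one sender group from the MAIS inequality of a subset of one of `nineSets`. -/
theorem sum_le_of_subset_nineSets {P : Finset (Fin 3)} {c : Fin 3 → ℝ} {r : Fin 5 → ℝ}
    (hr : r ∈ threeSenders.cccGroupRegion P c) {T F : Finset (Fin 5)} (Q : Finset (Fin 3))
    (hF : F ∈ nineSets) (hTF : T ⊆ F) (hT : T ⊆ threeSenders.groupMsgs P)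
    (hQ : (P.filter fun k => (threeSenders.msgs k ∩ T).Nonempty) = Q) :
    ∑ j ∈ T, r j ≤ ∑ k ∈ Q, c k :=
  hQ ▸ sum_le_of_mem_cccGroupRegion hr ((acyclicOn_of_mem_nineSets hF).mono hTF) hT

/-! ### Sender partitioning -/

/-- Certificates for cooperative composite coding with all three senders in one group. -/
def csCertificate : Fin 13 → BoundCertificate 3 5 :=
  ![⟨![{0}, {1}, {2}, {3}, {0, 1, 3, 4}],
      ![{0, 1, 2}, {1, 3}, {2, 3, 4}, {0, 3}, {0, 1, 3, 4}],
      [(2, {2}), (4, {0, 4}), (4, {0, 1, 3, 4})],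
      [(0, {0, 1}), (4, {0, 2}), (4, {0, 1, 2})]⟩,
    ⟨![{0}, {1}, {2}, {3}, {0, 1, 4}],
      ![{0, 1, 2}, {1, 3}, {2, 3, 4}, {0, 3}, {0, 1, 4}],
      [(2, {2}), (3, {3}), (4, {0, 4}), (4, {0, 1, 4})],
      [(0, {0, 1}), (4, {0, 2}), (4, {0, 1, 2})]⟩,
    ⟨![{0}, {1}, {2}, {3}, {0, 3, 4}],
      ![{0, 1, 2}, {1, 3}, {2, 3, 4}, {0, 3}, {0, 3, 4}],
      [(1, {1}), (2, {2}), (4, {0, 4}), (4, {0, 3, 4})],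
      [(0, {0, 1}), (4, {0, 2}), (4, {0, 1, 2})]⟩,
    ⟨![{0}, {1, 3}, {2}, {3}, {0, 4}],
      ![{0, 1, 2}, {1, 3}, {2, 3, 4}, {0, 3}, {0, 4}],
      [(1, {1, 3}), (2, {2}), (4, {0, 4}), (4, {0, 4})],
      [(0, {0, 1}), (4, {0, 2}), (4, {0, 1, 2})]⟩,
    ⟨![{0}, {1}, {2}, {3}, {0, 4}],
      ![{0, 1, 2}, {1}, {2, 3, 4}, {0, 3}, {0, 4}],
      [(1, {1}), (2, {2}), (3, {3}), (4, {0, 4}), (4, {0, 4})],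
      [(0, {0, 1}), (4, {0, 2}), (4, {0, 1, 2})]⟩,
    ⟨![{0}, {1}, {2}, {3}, {1, 3, 4}],
      ![{0, 1, 2}, {1, 3}, {2, 3, 4}, {0, 3}, {1, 3, 4}],
      [(0, {0}), (0, {0}), (2, {2}), (4, {4}), (4, {1, 3, 4})],
      [(0, {0, 1}), (4, {0, 2}), (4, {0, 1, 2})]⟩,
    ⟨![{0, 1}, {1}, {2}, {3}, {3, 4}],
      ![{0, 1, 2}, {1, 3}, {2, 3, 4}, {0, 3}, {3, 4}],
      [(0, {0}), (0, {0, 1}), (2, {2}), (4, {4}), (4, {3, 4})],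
      [(0, {0, 1}), (4, {0, 2}), (4, {0, 1, 2})]⟩,
    ⟨![{0}, {1}, {2}, {3}, {3, 4}],
      ![{0, 2}, {1, 3}, {2, 3, 4}, {0, 3}, {3, 4}],
      [(0, {0}), (0, {0}), (1, {1}), (2, {2}), (4, {4}), (4, {3, 4})],
      [(0, {0, 1}), (4, {0, 2}), (4, {0, 1, 2})]⟩,
    ⟨![{0, 1, 2}, {1}, {2}, {3}, {4}],
      ![{0, 1, 2}, {1, 3}, {2, 3, 4}, {0, 3}, {1, 4}],
      [(0, {0}), (0, {0, 1, 2}), (3, {3}), (4, {4}), (4, {4})],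
      [(0, {0, 1, 2}), (2, {2}), (4, {0, 1, 2})]⟩,
    ⟨![{0, 1}, {1}, {2}, {3}, {4}],
      ![{0, 1}, {1, 3}, {2, 3, 4}, {0, 3}, {1, 4}],
      [(0, {0}), (0, {0, 1}), (2, {2}), (3, {3}), (4, {4}), (4, {4})],
      [(0, {0, 1, 2}), (2, {2}), (4, {0, 1, 2})]⟩,
    ⟨![{0, 2}, {1}, {2}, {3}, {4}],
      ![{0, 2}, {1, 3}, {2, 3, 4}, {0, 3}, {1, 4}],
      [(0, {0}), (0, {0, 2}), (1, {1}), (3, {3}), (4, {4}), (4, {4})],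
      [(0, {0, 1, 2}), (2, {1, 2}), (4, {0, 2})]⟩,
    ⟨![{0}, {1, 3}, {2}, {3}, {4}],
      ![{0}, {1, 3}, {2, 3, 4}, {0, 3}, {1, 4}],
      [(0, {0}), (0, {0}), (1, {1, 3}), (2, {2}), (4, {4}), (4, {4})],
      [(0, {0, 1, 2}), (2, {2}), (4, {0, 1, 2})]⟩,
    ⟨![{0}, {1}, {2}, {3}, {4}],
      ![{0}, {1}, {2, 3, 4}, {0, 3}, {1, 4}],
      [(0, {0}), (0, {0}), (1, {1}), (2, {2}), (3, {3}), (4, {4}), (4, {4})],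
      [(0, {0, 1, 2}), (2, {2}), (4, {0, 1, 2})]⟩]

set_option synthInstance.maxHeartbeats 400000 in
set_option synthInstance.maxSize 100000 in
-- The 13 certificates cover all 64 decoding choices of receivers 0, 1 and 4. Receivers 2 and 3 need
-- no distinction, since each certificate allows their full range.
theorem exists_csCertificate : ∀ A ∈ ({0, 1, 2} : Finset (Fin 5)).powerset, 0 ∈ A →
    ∀ B ∈ ({1, 3} : Finset (Fin 5)).powerset, 1 ∈ B →
    ∀ E ∈ ({0, 1, 3, 4} : Finset (Fin 5)).powerset, 4 ∈ E → ∃ q,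
      ((csCertificate q).lower 0 ⊆ A ∧ A ⊆ (csCertificate q).upper 0) ∧ ((csCertificate q).lower 1
        ⊆ B ∧ B ⊆ (csCertificate q).upper 1) ∧
      ((csCertificate q).lower 4 ⊆ E ∧ E ⊆ (csCertificate q).upper 4) := by
  decide +kernel

set_option synthInstance.maxHeartbeats 400000 in
set_option synthInstance.maxSize 100000 in
theorem csCertificate_valid : ∀ q,
  ((csCertificate q).lower 2 = {2} ∧ (csCertificate q).lower 3 = {3} ∧ (csCertificate q).upper 2 =
  {2, 3, 4} ∧ (csCertificate q).upper 3 = {0, 3}) ∧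
    ((csCertificate q).loads.map fun v => v.2.card).sum = 7 ∧
    (∀ u ∈ (csCertificate q).decoders,
      u.1 ∈ threeSenders.groupMsgs Finset.univ ∧ u.2 ⊆ (csCertificate q).lower u.1 ∧
      u.2.Nonempty) ∧
    (∀ v ∈ (csCertificate q).loads, v.1 ∈ threeSenders.groupMsgs Finset.univ ∧ v.2 ⊆ Finset.univ ∧
      v.2.Nonempty) ∧
    (∀ i ∈ threeSenders.groupMsgs Finset.univ,
      (![2, 1, 1, 1, 2] : Fin 5 → ℕ) i ≤ (csCertificate q).decoders.countP fun u => i ∈ u.2) ∧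
    ∀ J ∈ threeSenders.composites Finset.univ,
      ((csCertificate q).decoders.countP fun u => J ⊆ (csCertificate q).upper u.1 ∪
        threeSenders.groupSide Finset.univ u.1 ∧
        (J ∩ u.2).Nonempty) ≤
      (csCertificate q).loads.countP fun v => J ∈ threeSenders.composites v.2 ∧
        J ∉ threeSenders.composites (Finset.univ \ v.2) ∧
        ¬ J ⊆ threeSenders.groupSide Finset.univ v.1 := by
  decide +kernel

theorem weighted_sum_le_seven {r : Fin 5 → ℝ}
    (hr : r ∈ threeSenders.cccGroupRegion Finset.univ threeSenders.cap) :
    ∑ i ∈ threeSenders.groupMsgs Finset.univ, ((![2, 1, 1, 1, 2] : Fin 5 → ℕ) i : ℝ) * r i ≤ 7 := by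
  simp only [cccGroupRegion, Set.mem_iUnion, Set.mem_ofPred_eq] at hr
  obtain ⟨D, hD, hr⟩ := hr
  have hu : ∀ j, j ∈ threeSenders.groupMsgs Finset.univ := by decide
  have hmax : ∀ j, threeSenders.groupMsgs Finset.univ \ threeSenders.groupSide Finset.univ j ⊆
      (![{0, 1, 2}, {1, 3}, {2, 3, 4}, {0, 3}, {0, 1, 3, 4}] : Fin 5 → Finset (Fin 5)) j := by
    decide +kernel
  have hsub : ∀ j, D j ⊆
      (![{0, 1, 2}, {1, 3}, {2, 3, 4}, {0, 3}, {0, 1, 3, 4}] : Fin 5 → Finset (Fin 5)) j :=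
    fun j => (hD j (hu j)).2.trans (hmax j)
  obtain ⟨q, h0, h1, h4⟩ := exists_csCertificate (D 0) (Finset.mem_powerset.2 (hsub 0))
    (hD 0 (hu 0)).1 (D 1) (Finset.mem_powerset.2 (hsub 1)) (hD 1 (hu 1)).1 (D 4)
    (Finset.mem_powerset.2 (hsub 4)) (hD 4 (hu 4)).1
  obtain ⟨⟨l2, l3, u2, u3⟩, hcard, hU, hV, hw, hJ⟩ := csCertificate_valid q
  have hrange : ∀ j, (csCertificate q).lower j ⊆ D j ∧ D j ⊆ (csCertificate q).upper j := by
    simp only [Fin.forall_fin_succ, IsEmpty.forall_iff, and_true]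
    refine ⟨h0, h1, ⟨?_, u2.symm ▸ hsub 2⟩, ⟨?_, u3.symm ▸ hsub 3⟩, h4⟩
    · exact l2.symm ▸ Finset.singleton_subset_iff.2 (hD 2 (hu 2)).1
    · exact l3.symm ▸ Finset.singleton_subset_iff.2 (hD 3 (hu 3)).1
  refine (sum_mul_le_of_certificate hr hD (csCertificate q) hU (fun u _ => (hrange u.1).1)
    (fun u _ => (hrange u.1).2) hV hw hJ).trans_eq ?_
  simp only [sum_cap_threeSenders]
  have := congrArg (Nat.cast : ℕ → ℝ) hcard
  simpa [Function.comp_def] using this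

theorem groupMsgs_threeSenders :
    threeSenders.groupMsgs {0} = {0, 1, 2} ∧ threeSenders.groupMsgs {1} = {1, 2, 3} ∧
    threeSenders.groupMsgs {2} = {0, 1, 3, 4} ∧ threeSenders.groupMsgs {0, 1} = {0, 1, 2, 3} ∧
    threeSenders.groupMsgs {0, 2} = {0, 1, 2, 3, 4} ∧
    threeSenders.groupMsgs {1, 2} = {0, 1, 2, 3, 4} := by
  decide

theorem senderGroup_cases : ∀ P : Finset (Fin 3), P.Nonempty → P = {0} ∨ P = {1} ∨ P = {2} ∨
    P = {0, 1} ∨ P = {0, 2} ∨ P = {1, 2} ∨ P = Finset.univ := by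
  decide

/-- The bounds are 2, 5, 7 for one, two, three senders. The MAIS inequalities suffice up to two
senders, but for all three they allow 15/2, so the last case needs the certificates. -/
theorem weighted_sum_le_of_card {P : Finset (Fin 3)} (hP : P.Nonempty) {r : Fin 5 → ℝ}
    (hr : r ∈ threeSenders.cccGroupRegion P threeSenders.cap) :
    ∑ i ∈ threeSenders.groupMsgs P, ((![2, 1, 1, 1, 2] : Fin 5 → ℕ) i : ℝ) * r i ≤
      (5 * P.card / 2 : ℕ) := by
  obtain ⟨g0, g1, g2, g01, g02, g12⟩ := groupMsgs_threeSenders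
  have key : ∀ (T F : Finset (Fin 5)) (n : ℕ), F ∈ nineSets → T ⊆ F →
      T ⊆ threeSenders.groupMsgs P →
      (P.filter fun k => (threeSenders.msgs k ∩ T).Nonempty).card = n → ∑ j ∈ T, r j ≤ n :=
    fun T F n hF hTF hT hn => hn ▸ (sum_le_of_subset_nineSets hr _ hF hTF hT rfl).trans_eq
      (sum_cap_threeSenders _)
  rcases senderGroup_cases P hP with rfl | rfl | rfl | rfl | rfl | rfl | rfl
  · have h1 := key {0, 1} {0, 1, 4} 1 (by decide) (by decide) (by decide) (by decide)
    have h2 := key {0, 2} {0, 2} 1 (by decide) (by decide) (by decide) (by decide)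
    rw [g0]
    simp at h1 h2 ⊢
    linarith
  · have h1 := key {1, 3} {1, 3, 4} 1 (by decide) (by decide) (by decide) (by decide)
    have h2 := key {2} {2} 1 (by decide) (by decide) (by decide) (by decide)
    rw [g1]
    simp at h1 h2 ⊢
    linarith
  · have h1 := key {0, 1, 4} {0, 1, 4} 1 (by decide) (by decide) (by decide) (by decide)
    have h2 := key {0, 3, 4} {0, 3, 4} 1 (by decide) (by decide) (by decide) (by decide)
    rw [g2]
    simp at h1 h2 ⊢
    linarith
  · have h1 := key {0, 1} {0, 1, 4} 2 (by decide) (by decide) (by decide) (by decide)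
    have h2 := key {0, 2} {0, 2} 2 (by decide) (by decide) (by decide) (by decide)
    have h3 := key {3} {3, 4} 1 (by decide) (by decide) (by decide) (by decide)
    rw [g01]
    simp at h1 h2 h3 ⊢
    linarith
  · have h1 := key {0, 1, 4} {0, 1, 4} 2 (by decide) (by decide) (by decide) (by decide)
    have h2 := key {0, 3, 4} {0, 3, 4} 2 (by decide) (by decide) (by decide) (by decide)
    have h3 := key {2} {2} 1 (by decide) (by decide) (by decide) (by decide)
    rw [g02]
    simp at h1 h2 h3 ⊢
    linarith
  · have h1 := key {0, 1, 4} {0, 1, 4} 2 (by decide) (by decide) (by decide) (by decide)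
    have h2 := key {0, 3, 4} {0, 3, 4} 2 (by decide) (by decide) (by decide) (by decide)
    have h3 := key {2} {2} 1 (by decide) (by decide) (by decide) (by decide)
    rw [g12]
    simp at h1 h2 h3 ⊢
    linarith
  · exact (weighted_sum_le_seven hr).trans_eq (by simp)

/-- The partitions give 7, 5 + 2 and 2 + 2 + 2. -/
theorem sum_card_le_of_isSenderPartition : ∀ Gs : Finset (Finset (Fin 3)),
    IsSenderPartition Gs → ∑ P ∈ Gs, 5 * P.card / 2 ≤ 7 := by
  unfold IsSenderPartition IsGrouping
  decide +kernel

theorem closure_convexHull_subset_halfSpace {S : Set (Fin 5 → ℝ)} (w : Fin 5 → ℕ) (b : ℝ)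
    (h : ∀ R ∈ S, ∑ j, (w j : ℝ) * R j ≤ b) :
    closure (convexHull ℝ S) ⊆ {R : Fin 5 → ℝ | ∑ j, (w j : ℝ) * R j ≤ b} := by
  refine closure_minimal (convexHull_min h (convex_halfSpace_le ⟨fun x y => ?_, fun a x => ?_⟩ b))
    (isClosed_le (by fun_prop) continuous_const)
  · simp [mul_add, Finset.sum_add_distrib]
  · simp only [Pi.smul_apply, smul_eq_mul, Finset.mul_sum]
    exact Finset.sum_congr rfl fun j _ => by ring

theorem weighted_sum_combine {Gs : Finset (Finset (Fin 3))} {r : Finset (Fin 3) → Fin 5 → ℝ}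
    {R : Fin 5 → ℝ} (hR : ∀ j, R j = ∑ P ∈ Gs with j ∈ threeSenders.groupMsgs P, r P j)
    (w : Fin 5 → ℕ) : ∑ j, (w j : ℝ) * R j =
      ∑ P ∈ Gs, ∑ j ∈ threeSenders.groupMsgs P, (w j : ℝ) * r P j := by
  have := sum_combine (p := threeSenders) (Gs := Gs) (r := r) (fun j => (w j : ℝ)) Finset.univ
  simp only [Finset.univ_inter] at this
  rw [← this]
  exact Finset.sum_congr rfl fun j _ => by rw [hR]

theorem closure_regionCS_subset : closure threeSenders.regionCS ⊆
    {R : Fin 5 → ℝ | ∑ j, ((![2, 1, 1, 1, 2] : Fin 5 → ℕ) j : ℝ) * R j ≤ 7} := by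
  refine closure_convexHull_subset_halfSpace _ _ fun R hR => ?_
  simp only [Set.mem_iUnion, Set.mem_ofPred_eq] at hR
  obtain ⟨Gs, hGs, r, hr, hR⟩ := hR
  rw [weighted_sum_combine hR]
  refine (Finset.sum_le_sum fun P hP =>
    weighted_sum_le_of_card (hGs.1.1 P hP) (hr P hP)).trans ?_
  exact_mod_cast sum_card_le_of_isSenderPartition Gs hGs

theorem notMem_closure_regionCS :
    (![3 / 2, 1, 3 / 2, 1, 1 / 2] : Fin 5 → ℝ) ∉ closure threeSenders.regionCS := by
  intro h
  have := closure_regionCS_subset h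
  simp [Fin.sum_univ_succ] at this
  norm_num at this

/-! ### Distributed composite coding -/

/-- Certificates for distributed composite coding in groups of at least two senders. -/
def lsCertificate : Fin 5 → BoundCertificate 3 5 :=
  -- The load lists are empty: loads of single senders, common to all five certificates, are in
  -- `lsLoads`.
  ![⟨![{0, 1, 2}, {1}, {2}, {3}, {4}],
      ![{0, 1, 2}, {1, 3}, {2, 3, 4}, {0, 3}, {0, 1, 3, 4}],
      [(0, {0}), (0, {0, 1, 2}), (3, {3})],
      []⟩,
    ⟨![{0, 1}, {1}, {2}, {3}, {4}],
      ![{0, 1}, {1, 3}, {2, 3, 4}, {0, 3}, {0, 1, 3, 4}],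
      [(0, {0}), (0, {0, 1}), (2, {2}), (3, {3})],
      []⟩,
    ⟨![{0, 2}, {1}, {2}, {3}, {4}],
      ![{0, 2}, {1, 3}, {2, 3, 4}, {0, 3}, {0, 1, 3, 4}],
      [(0, {0}), (0, {0, 2}), (1, {1}), (3, {3})],
      []⟩,
    ⟨![{0}, {1, 3}, {2}, {3}, {4}],
      ![{0}, {1, 3}, {2, 3, 4}, {0, 3}, {0, 1, 3, 4}],
      [(0, {0}), (0, {0}), (1, {1, 3}), (2, {2})],
      []⟩,
    ⟨![{0}, {1}, {2}, {3}, {4}],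
      ![{0}, {1}, {2, 3, 4}, {0, 3}, {0, 1, 3, 4}],
      [(0, {0}), (0, {0}), (1, {1}), (2, {2}), (3, {3})],
      []⟩]

/-- The load conditions for distributed composite coding in groups of at least two senders. -/
def lsLoads : List (Fin 5 × Fin 3) := [(0, 0), (0, 0), (0, 1), (0, 2), (0, 2), (1, 1), (1, 2)]

theorem exists_lsCertificate : ∀ A ∈ ({0, 1, 2} : Finset (Fin 5)).powerset, 0 ∈ A →
    ∀ B ∈ ({1, 3} : Finset (Fin 5)).powerset, 1 ∈ B → ∃ q,
      ((lsCertificate q).lower 0 ⊆ A ∧ A ⊆ (lsCertificate q).upper 0) ∧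
      ((lsCertificate q).lower 1 ⊆ B ∧ B ⊆ (lsCertificate q).upper 1) := by
  decide +kernel

set_option synthInstance.maxHeartbeats 400000 in
set_option synthInstance.maxSize 100000 in
theorem lsCertificate_valid : ∀ P : Finset (Fin 3), 2 ≤ P.card → ∀ q,
    (∀ u ∈ (lsCertificate q).decoders, u.1 ∈ threeSenders.groupMsgs P ∧
      u.2 ⊆ (lsCertificate q).lower u.1 ∧ u.2.Nonempty) ∧
    (∀ v ∈ lsLoads, v.1 ∈ threeSenders.groupMsgs P) ∧
    (∀ i ∈ threeSenders.groupMsgs P,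
      (![2, 1, 1, 1, 0] : Fin 5 → ℕ) i ≤ (lsCertificate q).decoders.countP fun u => i ∈ u.2) ∧
    ∀ k ∈ P, ∀ J ⊆ threeSenders.msgs k,
      ((lsCertificate q).decoders.countP fun u =>
        J ⊆ (lsCertificate q).upper u.1 ∪ threeSenders.groupSide P u.1 ∧ (J ∩ u.2).Nonempty) ≤
      lsLoads.countP fun v => v.2 = k ∧ ¬ J ⊆ threeSenders.groupSide P v.1 := by
  decide +kernel

theorem lsCertificate_range : ∀ q, (lsCertificate q).lower 2 = {2} ∧
    (lsCertificate q).lower 3 = {3} ∧ (lsCertificate q).upper 2 = {2, 3, 4} ∧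
    (lsCertificate q).upper 3 = {0, 3} ∧ ∀ u ∈ (lsCertificate q).decoders, u.1 ≠ 4 := by
  decide +kernel

theorem groupMsgs_sdiff_groupSide_subset : ∀ P : Finset (Fin 3), ∀ j,
    threeSenders.groupMsgs P \ threeSenders.groupSide P j ⊆
      (![{0, 1, 2}, {1, 3}, {2, 3, 4}, {0, 3}, {0, 1, 3, 4}] : Fin 5 → Finset (Fin 5)) j := by
  decide +kernel

theorem subset_groupMsgs_of_two_le_card : ∀ P : Finset (Fin 3), 2 ≤ P.card →
    ({0, 1, 2, 3} : Finset (Fin 5)) ⊆ threeSenders.groupMsgs P := by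
  decide +kernel

/-- Prices of the senders for distributed composite coding. -/
theorem weighted_sum_le_price {P : Finset (Fin 3)} (hP : P.Nonempty) {c : Fin 3 → ℝ}
    (hc : ∀ k ∈ P, 0 < c k) {r : Fin 5 → ℝ} (hr : r ∈ threeSenders.dccGroupRegion P c) :
    ∑ i ∈ threeSenders.groupMsgs P, ((![2, 1, 1, 1, 0] : Fin 5 → ℕ) i : ℝ) * r i ≤
      ∑ k ∈ P, ((![2, 2, 3] : Fin 3 → ℕ) k : ℝ) * c k := by
  obtain ⟨g0, g1, g2, -⟩ := groupMsgs_threeSenders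
  have hr' := dccGroupRegion_subset_cccGroupRegion _ _ _ hr
  have two : 2 ≤ P.card → ∑ i ∈ threeSenders.groupMsgs P,
      ((![2, 1, 1, 1, 0] : Fin 5 → ℕ) i : ℝ) * r i ≤
        ∑ k ∈ P, ((![2, 2, 3] : Fin 3 → ℕ) k : ℝ) * c k := by
    intro h2
    simp only [dccGroupRegion, Set.mem_iUnion, Set.mem_ofPred_eq] at hr
    obtain ⟨D, hD, hr⟩ := hr
    have hg := subset_groupMsgs_of_two_le_card P h2
    have hmem : ∀ j ∈ threeSenders.groupMsgs P, j ∈ D j := fun j hj => (hD j hj).1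
    have hsub : ∀ j ∈ threeSenders.groupMsgs P, D j ⊆
        (![{0, 1, 2}, {1, 3}, {2, 3, 4}, {0, 3}, {0, 1, 3, 4}] : Fin 5 → Finset (Fin 5)) j :=
      fun j hj => (hD j hj).2.trans (groupMsgs_sdiff_groupSide_subset P j)
    have m0 := hg (show (0 : Fin 5) ∈ _ by decide)
    have m1 := hg (show (1 : Fin 5) ∈ _ by decide)
    have m2 := hg (show (2 : Fin 5) ∈ _ by decide)
    have m3 := hg (show (3 : Fin 5) ∈ _ by decide)
    obtain ⟨q, h0, h1⟩ := exists_lsCertificate (D 0) (Finset.mem_powerset.2 (hsub 0 m0))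
      (hmem 0 m0) (D 1) (Finset.mem_powerset.2 (hsub 1 m1)) (hmem 1 m1)
    obtain ⟨hU, hV, hw, hJ⟩ := lsCertificate_valid P h2 q
    obtain ⟨l2, l3, u2, u3, h4⟩ := lsCertificate_range q
    have hrange : ∀ j, j ≠ 4 →
        (lsCertificate q).lower j ⊆ D j ∧ D j ⊆ (lsCertificate q).upper j := by
      simp only [Fin.forall_fin_succ, IsEmpty.forall_iff, and_true]
      refine ⟨fun _ => h0, fun _ => h1, fun _ => ⟨?_, u2.symm ▸ hsub 2 m2⟩,
        fun _ => ⟨?_, u3.symm ▸ hsub 3 m3⟩, fun h => absurd rfl h⟩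
      · exact l2.symm ▸ Finset.singleton_subset_iff.2 (hmem 2 m2)
      · exact l3.symm ▸ Finset.singleton_subset_iff.2 (hmem 3 m3)
    refine (sum_mul_le_of_certificate_dcc hr hD (lsCertificate q) lsLoads hU
      (fun u hu => (hrange u.1 (h4 u hu)).1) (fun u hu => (hrange u.1 (h4 u hu)).2)
      hV hw hJ).trans_eq (Finset.sum_congr rfl fun k _ => ?_)
    have : ∀ k, lsLoads.countP (fun v => v.2 = k) = (![2, 2, 3] : Fin 3 → ℕ) k := by decide
    rw [this]
  rcases senderGroup_cases P hP with rfl | rfl | rfl | rfl | rfl | rfl | rfl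
  · have h1 := sum_le_of_subset_nineSets hr' {0} (T := {0, 1}) (F := {0, 1, 4}) (by decide)
      (by decide) (by decide) (by decide)
    have h2 := sum_le_of_subset_nineSets hr' {0} (T := {0, 2}) (F := {0, 2}) (by decide)
      (by decide) (by decide) (by decide)
    rw [g0]
    simp at h1 h2 ⊢
    linarith
  · have h1 := sum_le_of_subset_nineSets hr' {1} (T := {1, 3}) (F := {1, 3, 4}) (by decide)
      (by decide) (by decide) (by decide)
    have h2 := sum_le_of_subset_nineSets hr' {1} (T := {2}) (F := {2}) (by decide)
      (by decide) (by decide) (by decide)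
    rw [g1]
    simp at h1 h2 ⊢
    linarith
  · have h1 := sum_le_of_subset_nineSets hr' {2} (T := {0, 1}) (F := {0, 1, 4}) (by decide)
      (by decide) (by decide) (by decide)
    have h2 := sum_le_of_subset_nineSets hr' {2} (T := {0, 3}) (F := {0, 3, 4}) (by decide)
      (by decide) (by decide) (by decide)
    -- MAIS gives `2 * c 2`; positivity lifts this to the price `3 * c 2`.
    have h3 := hc 2 (by decide)
    rw [g2]
    simp at h1 h2 ⊢
    linarith
  all_goals exact two (by decide)

/-- The group bounds are linear in the link capacities with prices independent of the group. They
therefore survive every link split and total at most 2 + 2 + 3. -/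
theorem closure_regionLS_subset : closure threeSenders.regionLS ⊆
    {R : Fin 5 → ℝ | ∑ j, ((![2, 1, 1, 1, 0] : Fin 5 → ℕ) j : ℝ) * R j ≤ 7} := by
  refine closure_convexHull_subset_halfSpace _ _ fun R hR => ?_
  simp only [Set.mem_iUnion, Set.mem_ofPred_eq] at hR
  obtain ⟨Gs, hGs, c, hc, r, hr, hR⟩ := hR
  rw [weighted_sum_combine hR]
  refine (Finset.sum_le_sum fun P hP =>
    weighted_sum_le_price (hGs.1 P hP) (hc.1 P hP) (hr P hP)).trans ?_
  calc ∑ P ∈ Gs, ∑ k ∈ P, ((![2, 2, 3] : Fin 3 → ℕ) k : ℝ) * c P k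
      = ∑ k, ((![2, 2, 3] : Fin 3 → ℕ) k : ℝ) * ∑ P ∈ Gs with k ∈ P, c P k := by
        simp_rw [Finset.mul_sum, Finset.sum_filter]
        rw [Finset.sum_comm]
        refine Finset.sum_congr rfl fun P _ => ?_
        rw [← Finset.sum_filter, Finset.filter_univ_mem]
    _ ≤ ∑ k, ((![2, 2, 3] : Fin 3 → ℕ) k : ℝ) * 1 :=
        Finset.sum_le_sum fun k _ => mul_le_mul_of_nonneg_left (hc.2 k) (Nat.cast_nonneg _)
    _ ≤ 7 := by
        simp [Fin.sum_univ_succ]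
        norm_num

theorem notMem_closure_regionLS :
    (![3 / 2, 3 / 2, 3 / 2, 3 / 2, 0] : Fin 5 → ℝ) ∉ closure threeSenders.regionLS := by
  intro h
  have := closure_regionLS_subset h
  simp [Fin.sum_univ_succ] at this
  norm_num at this

/-! ### Strict inclusions. -/

theorem mem_maisRegion_of_regionCS_gap :
    (![3 / 2, 1, 3 / 2, 1, 1 / 2] : Fin 5 → ℝ) ∈ threeSenders.maisRegion := by
  rw [maisRegion_threeSenders]
  refine ⟨fun j => ?_, ?_⟩
  · fin_cases j <;> norm_num
  · simp only [NineBounds, Matrix.cons_val]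
    norm_num

theorem mem_maisRegion_of_regionLS_gap :
    (![3 / 2, 3 / 2, 3 / 2, 3 / 2, 0] : Fin 5 → ℝ) ∈ threeSenders.maisRegion := by
  rw [maisRegion_threeSenders]
  refine ⟨fun j => ?_, ?_⟩
  · fin_cases j <;> norm_num
  · simp only [NineBounds, Matrix.cons_val]
    norm_num

theorem regionCS_ssubset_regionCLS : threeSenders.regionCS ⊂ threeSenders.regionCLS := by
  refine (regionCS_subset_regionCLS _).ssubset_of_ne fun h => notMem_closure_regionCS ?_
  rw [h, closure_regionCLS]
  exact mem_maisRegion_of_regionCS_gap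

theorem regionLS_ssubset_regionCLS : threeSenders.regionLS ⊂ threeSenders.regionCLS := by
  refine (regionLS_subset_regionCLS _).ssubset_of_ne fun h => notMem_closure_regionLS ?_
  rw [h, closure_regionCLS]
  exact mem_maisRegion_of_regionLS_gap

theorem closure_regionLS_ssubset_maisRegion :
    closure threeSenders.regionLS ⊂ threeSenders.maisRegion := by
  refine LE.le.ssubset_of_ne ?_ fun h => notMem_closure_regionLS ?_
  · rw [← closure_regionCLS]
    exact closure_mono (regionLS_subset_regionCLS _)
  · rw [h]
    exact mem_maisRegion_of_regionLS_gap

namespace Problem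

variable {K N : ℕ}

/-! ### The MAIS bound holds for all codes -/

/-- Correctly decoded messages are determined by those outside an acyclic set together with the
outputs of the senders that meet the set. -/
theorem IndexCode.eq_of_acyclicOn {p : Problem K N} {R : Fin N → ℝ} {n : ℕ}
    (code : p.IndexCode R n) {T : Finset (Fin N)} (hT : p.AcyclicOn T) {m m' : Messages R n}
    (hm : ∀ j, code.estimate m j = m j) (hm' : ∀ j, code.estimate m' j = m' j)
    (hout : ∀ j ∉ T, m j = m' j)
    (hk : ∀ k, (p.msgs k ∩ T).Nonempty → code.outputs m k = code.outputs m' k) : m = m' := by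
  -- A sender not meeting `T` sees only messages on which the two tuples agree.
  have houts : code.outputs m = code.outputs m' := by
    funext k
    by_cases h : (p.msgs k ∩ T).Nonempty
    · exact hk k h
    · rw [Finset.not_nonempty_iff_eq_empty, ← Finset.disjoint_iff_inter_eq_empty] at h
      unfold IndexCode.outputs
      congr 1
      funext i
      exact hout i (Finset.disjoint_left.1 h i.2)
  by_contra hne
  obtain ⟨j₀, hj₀⟩ := Function.ne_iff.1 hne
  have hmem : ∀ {j}, m j ≠ m' j → j ∈ T := fun h => by
    by_contra hj
    exact h (hout _ hj)
  -- A sink of the disagreement set has the same outputs and side information for both tuples, hence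
  -- the same estimate.
  obtain ⟨j, hj, hsink⟩ := (hT.mono (Finset.filter_subset (fun j => m j ≠ m' j) T)).exists_sink
    ⟨j₀, Finset.mem_filter.2 ⟨hmem hj₀, hj₀⟩⟩
  refine (Finset.mem_filter.1 hj).2 ?_
  rw [← hm j, ← hm' j]
  unfold IndexCode.estimate
  rw [houts]
  congr 1
  funext i
  by_contra h
  exact Finset.disjoint_left.1 hsink i.2 (Finset.mem_filter.2 ⟨hmem h, h⟩)

theorem IndexCode.card_correct_mul_le {p : Problem K N} {R : Fin N → ℝ} {n : ℕ}
    (code : p.IndexCode R n) {T : Finset (Fin N)} (hT : p.AcyclicOn T) :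
    Nat.card {m : Messages R n // ∀ j, code.estimate m j = m j} *
      2 ^ ∑ j ∈ T, ⌈(n : ℝ) * R j⌉₊ ≤
    Nat.card (Messages R n) *
      2 ^ ∑ k with (p.msgs k ∩ T).Nonempty, ⌊(n : ℝ) * p.cap k⌋₊ := by
  let Φ : {m : Messages R n // ∀ j, code.estimate m j = m j} →
      ((j : {j // j ∉ T}) → Fin (2 ^ ⌈(n : ℝ) * R j⌉₊)) ×
        ((k : {k // (p.msgs k ∩ T).Nonempty}) → Fin (2 ^ ⌊(n : ℝ) * p.cap k⌋₊)) :=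
    fun m => (fun j => m.1 j, fun k => code.outputs m.1 k)
  have hΦ : Function.Injective Φ := by
    intro m m' h
    refine Subtype.ext (code.eq_of_acyclicOn hT m.2 m'.2 (fun j hj => ?_) fun k hk => ?_)
    · exact congrFun (congrArg Prod.fst h) ⟨j, hj⟩
    · exact congrFun (congrArg Prod.snd h) ⟨k, hk⟩
  have hcard := Nat.card_le_card_of_injective Φ hΦ
  rw [Nat.card_prod, Nat.card_eq_fintype_card (α := ∀ j : {j // j ∉ T}, _),
    Nat.card_eq_fintype_card (α := ∀ k : {k // (p.msgs k ∩ T).Nonempty}, _), Fintype.card_pi,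
    Fintype.card_pi] at hcard
  simp only [Fintype.card_fin] at hcard
  have hM : Nat.card (Messages R n) = 2 ^ (∑ j ∈ T, ⌈(n : ℝ) * R j⌉₊) *
      ∏ j : {j // j ∉ T}, 2 ^ ⌈(n : ℝ) * R j⌉₊ := by
    rw [Nat.card_eq_fintype_card, Fintype.card_pi]
    simp only [Fintype.card_fin]
    rw [← Finset.prod_pow_eq_pow_sum, ← Finset.prod_mul_prod_compl T]
    congr 1
    exact Finset.prod_subtype _ (by simp) _
  have hK : ∏ k : {k // (p.msgs k ∩ T).Nonempty}, 2 ^ ⌊(n : ℝ) * p.cap k⌋₊ =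
      2 ^ ∑ k with (p.msgs k ∩ T).Nonempty, ⌊(n : ℝ) * p.cap k⌋₊ := by
    rw [← Finset.prod_pow_eq_pow_sum]
    exact (Finset.prod_subtype _ (by simp) fun k => 2 ^ ⌊(n : ℝ) * p.cap k⌋₊).symm
  rw [hK] at hcard
  rw [hM]
  calc _ ≤ _ := Nat.mul_le_mul_right _ hcard
    _ = _ := by ring

/-- At error at most 1/2, at least half of the message tuples are decoded correctly. The lost factor
2 is the additive bit, which vanishes after division by `n`. -/
theorem IndexCode.sum_le_of_errorProb_le {p : Problem K N} {R : Fin N → ℝ} {n : ℕ}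
    (code : p.IndexCode R n) (he : code.errorProb ≤ 1 / 2) {T : Finset (Fin N)}
    (hT : p.AcyclicOn T) :
    ∑ j ∈ T, ⌈(n : ℝ) * R j⌉₊ ≤ 1 + ∑ k with (p.msgs k ∩ T).Nonempty, ⌊(n : ℝ) * p.cap k⌋₊ := by
  have h := code.card_correct_mul_le hT
  have hM : 0 < Nat.card (Messages R n) := by
    rw [Nat.card_eq_fintype_card, Fintype.card_pi]
    exact Finset.prod_pos fun j _ => by simp
  have hsplit : Nat.card {m : Messages R n // ∀ j, code.estimate m j = m j} +
      Nat.card {m : Messages R n // ∃ j, code.estimate m j ≠ m j} = Nat.card (Messages R n) := by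
    classical
    have := Nat.card_congr
      (Equiv.sumCompl fun m : Messages R n => ∀ j, code.estimate m j = m j)
    rw [Nat.card_sum] at this
    simpa only [not_forall] using this
  have hbad : 2 * Nat.card {m : Messages R n // ∃ j, code.estimate m j ≠ m j} ≤
      Nat.card (Messages R n) := by
    unfold IndexCode.errorProb at he
    rw [div_le_iff₀ (by exact_mod_cast hM)] at he
    have : (2 : ℝ) * Nat.card {m : Messages R n // ∃ j, code.estimate m j ≠ m j} ≤
      Nat.card (Messages R n) := by linarith
    exact_mod_cast this
  have hgood : Nat.card (Messages R n) ≤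
      2 * Nat.card {m : Messages R n // ∀ j, code.estimate m j = m j} := by omega
  rw [← Nat.pow_le_pow_iff_right (a := 2) (by norm_num), pow_add, pow_one]
  refine Nat.le_of_mul_le_mul_left ?_ hM
  calc _ ≤ 2 * Nat.card {m : Messages R n // ∀ j, code.estimate m j = m j} * _ :=
        Nat.mul_le_mul_right _ hgood
    _ ≤ 2 * (Nat.card (Messages R n) * _) := by rw [mul_assoc]; exact Nat.mul_le_mul_left _ h
    _ = _ := by ring

theorem Achievable.mem_maisRegion {p : Problem K N} {R : Fin N → ℝ} (h : p.Achievable R) :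
    R ∈ p.maisRegion := by
  obtain ⟨h0, code, hcode⟩ := h
  refine ⟨h0, fun T hT => ?_⟩
  have hev : ∀ᶠ n : ℕ in atTop, ∑ j ∈ T, R j ≤
      1 / (n : ℝ) + ∑ k with (p.msgs k ∩ T).Nonempty, p.cap k := by
    filter_upwards [hcode.eventually_le_const (by norm_num : (0 : ℝ) < 1 / 2),
      eventually_gt_atTop 0] with n hn hn0
    have hn0' : (0 : ℝ) < n := Nat.cast_pos.2 hn0
    have h1 := (code n).sum_le_of_errorProb_le hn hT
    have h2 : (n : ℝ) * ∑ j ∈ T, R j ≤ 1 + n * ∑ k with (p.msgs k ∩ T).Nonempty, p.cap k := by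
      calc (n : ℝ) * ∑ j ∈ T, R j ≤ ∑ j ∈ T, (⌈(n : ℝ) * R j⌉₊ : ℝ) := by
            rw [Finset.mul_sum]
            exact Finset.sum_le_sum fun j _ => Nat.le_ceil _
        _ ≤ 1 + ∑ k with (p.msgs k ∩ T).Nonempty, (⌊(n : ℝ) * p.cap k⌋₊ : ℝ) := by
            exact_mod_cast h1
        _ ≤ _ := by
            rw [Finset.mul_sum]
            exact add_le_add_right (Finset.sum_le_sum fun k _ =>
              Nat.floor_le (mul_nonneg hn0'.le (p.cap_pos k).le)) _
    refine le_of_mul_le_mul_left (h2.trans_eq ?_) hn0'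
    field_simp
  have hlim : Tendsto (fun n : ℕ => 1 / (n : ℝ) + ∑ k with (p.msgs k ∩ T).Nonempty, p.cap k) atTop
      (𝓝 (0 + ∑ k with (p.msgs k ∩ T).Nonempty, p.cap k)) :=
    tendsto_one_div_atTop_nhds_zero_nat.add_const _
  rw [zero_add] at hlim
  exact ge_of_tendsto hlim hev

theorem capacityRegion_subset_maisRegion (p : Problem K N) : p.capacityRegion ⊆ p.maisRegion :=
  closure_minimal (fun _ h => h.mem_maisRegion) p.isClosed_maisRegion

/-! ### Zero-error codes -/

/-- There is a code without errors for the message alphabets `α` and the output alphabets `β`. -/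
def HasZeroErrorCode (p : Problem K N) (α : Fin N → Type) (β : Fin K → Type) : Prop :=
  ∃ f : (k : Fin K) → ((j : Fin N) → α j) → β k,
    (∀ k m m', (∀ i ∈ p.msgs k, m i = m' i) → f k m = f k m') ∧
    ∀ j m m', (∀ k, f k m = f k m') → (∀ i ∈ p.side j, m i = m' i) → m j = m' j

/-- Codes run in parallel, coordinate by coordinate. -/
theorem HasZeroErrorCode.pi {p : Problem K N} {ι : Type} {α : ι → Fin N → Type}
    {β : ι → Fin K → Type} (h : ∀ i, p.HasZeroErrorCode (α i) (β i)) :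
    p.HasZeroErrorCode (fun j => ∀ i, α i j) fun k => ∀ i, β i k := by
  choose f hf hdec using h
  refine ⟨fun k m i => f i k fun j => m j i, fun k m m' hm => ?_, fun j m m' hk hm => ?_⟩
  · funext i
    exact hf i k _ _ fun j hj => congrFun (hm j hj) i
  · funext i
    exact hdec i j (fun j => m j i) (fun j => m' j i) (fun k => congrFun (hk k) i)
      fun l hl => congrFun (hm l hl) i

theorem HasZeroErrorCode.of_embedding {p : Problem K N} {α α' : Fin N → Type}
    {β β' : Fin K → Type} (h : p.HasZeroErrorCode α β) (u : ∀ j, α' j ↪ α j)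
    (v : ∀ k, β k ↪ β' k) : p.HasZeroErrorCode α' β' := by
  obtain ⟨f, hf, hdec⟩ := h
  refine ⟨fun k m => v k (f k fun j => u j (m j)), fun k m m' hm => ?_, fun j m m' hk hm => ?_⟩
  · exact congrArg (v k) (hf k _ _ fun i hi => congrArg (u i) (hm i hi))
  · exact (u j).injective (hdec j (fun j => u j (m j)) (fun j => u j (m' j))
      (fun k => (v k).injective (hk k)) fun i hi => congrArg (u i) (hm i hi))

theorem HasZeroErrorCode.exists_indexCode {p : Problem K N} {R : Fin N → ℝ} {n : ℕ}
    (h : p.HasZeroErrorCode (fun j => Fin (2 ^ ⌈(n : ℝ) * R j⌉₊))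
      fun k => Fin (2 ^ ⌊(n : ℝ) * p.cap k⌋₊)) :
    ∃ code : p.IndexCode R n, code.errorProb = 0 := by
  classical
  obtain ⟨f, hf, hdec⟩ := h
  -- The tuple `z` fills in messages unknown to a sender, on which `f k` does not depend. The
  -- decoder takes any tuple consistent with its data, since all of them agree at `j`.
  let z : Messages R n := fun j => ⟨0, by positivity⟩
  let code : p.IndexCode R n :=
    { enc := fun k x => f k fun j => if hj : j ∈ p.msgs k then x ⟨j, hj⟩ else z j
      dec := fun j o s => if hm : ∃ m : Messages R n, (fun k => f k m) = o ∧
        (fun i : {i // i ∈ p.side j} => m i) = s then hm.choose j else z j }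
  have hout : ∀ m, code.outputs m = fun k => f k m := by
    intro m
    funext k
    exact hf k _ _ fun i hi => dif_pos hi
  have hest : ∀ m j, code.estimate m j = m j := by
    intro m j
    have hex : ∃ m' : Messages R n, (fun k => f k m') = code.outputs m ∧
        (fun i : {i // i ∈ p.side j} => m' i) =
          fun i : {i // i ∈ p.side j} => m i := ⟨m, (hout m).symm, rfl⟩
    have hval : code.estimate m j = hex.choose j := dif_pos hex
    obtain ⟨h1, h2⟩ := hex.choose_spec
    replace h1 := h1.trans (hout m)
    rw [hval]
    exact hdec j _ _ (fun k => congrFun h1 k) fun i hi => congrFun h2 ⟨i, hi⟩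
  refine ⟨code, ?_⟩
  have : IsEmpty {m : Messages R n // ∃ j, code.estimate m j ≠ m j} :=
    ⟨fun ⟨m, j, hj⟩ => hj (hest m j)⟩
  simp [IndexCode.errorProb]

theorem achievable_of_eventually {p : Problem K N} {R : Fin N → ℝ} (h0 : ∀ j, 0 ≤ R j)
    (h : ∀ᶠ n : ℕ in atTop, p.HasZeroErrorCode (fun j => Fin (2 ^ ⌈(n : ℝ) * R j⌉₊))
      fun k => Fin (2 ^ ⌊(n : ℝ) * p.cap k⌋₊)) : p.Achievable R := by
  classical
  -- An arbitrary code for the finitely many lengths without a zero-error code.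
  let triv : ∀ n, p.IndexCode R n := fun n =>
    ⟨fun _ _ => ⟨0, by positivity⟩, fun _ _ _ => ⟨0, by positivity⟩⟩
  refine ⟨h0, fun n => if hc : ∃ code : p.IndexCode R n, code.errorProb = 0 then hc.choose
    else triv n, tendsto_const_nhds.congr' ?_⟩
  filter_upwards [h] with n hn
  rw [dif_pos hn.exists_indexCode]
  exact hn.exists_indexCode.choose_spec.symm

end Problem

/-! ### XOR codes for the modes and achievability. -/

/-- The messages whose sum is sent by each sender in the elementary modes. -/
def modeXor : Fin 10 → Fin 3 → Finset (Fin 5) :=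
  ![![∅, ∅, {4}], ![∅, ∅, {1}], ![{0, 1, 2}, {1, 2, 3}, ∅], ![∅, {3}, ∅],
    ![{0, 1, 2}, ∅, {0, 3}], ![∅, {1, 2}, ∅], ![{0, 2}, ∅, {0, 4}], ![{1, 2}, ∅, ∅],
    ![∅, {1, 2, 3}, {0, 3}], ![{0}, ∅, ∅]]

theorem modeXor_subset : ∀ m k, modeXor m k ⊆ threeSenders.msgs k := by decide

theorem modeXor_eq_empty : ∀ m k, k ∉ modeSenders m → modeXor m k = ∅ := by decide

/-- By linearity it is enough to examine the difference `v` of two indistinguishable message tuples.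
-/
theorem modeXor_decodable : ∀ m j, ∀ v : Fin 5 → ZMod 2, (∀ i ∉ modeMsgs m, v i = 0) →
    (∀ k, ∑ i ∈ modeXor m k, v i = 0) → (∀ i ∈ threeSenders.side j, v i = 0) → v j = 0 := by
  decide +kernel

/-- Messages not served and senders not used have the one-element alphabet `{0}`, so they cost
nothing when modes are combined. -/
theorem hasZeroErrorCode_mode (m : Fin 10) : threeSenders.HasZeroErrorCode
    (fun j => {x : ZMod 2 // j ∉ modeMsgs m → x = 0})
    fun k => {x : ZMod 2 // k ∉ modeSenders m → x = 0} := by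
  refine ⟨fun k x => ⟨∑ i ∈ modeXor m k, (x i).1, fun hk => ?_⟩, fun k x y h => ?_,
    fun j x y hk hs => ?_⟩
  · rw [modeXor_eq_empty m k hk, Finset.sum_empty]
  · exact Subtype.ext (Finset.sum_congr rfl fun i hi => by rw [h i (modeXor_subset m k hi)])
  · refine Subtype.ext (sub_eq_zero.1 (modeXor_decodable m j (fun i => (x i).1 - (y i).1)
      (fun i hi => ?_) (fun k => ?_) fun i hi => ?_))
    · rw [(x i).2 hi, (y i).2 hi, sub_zero]
    · rw [Finset.sum_sub_distrib, sub_eq_zero]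
      exact congrArg Subtype.val (hk k)
    · rw [hs i hi, sub_self]

theorem card_subtype_zmod_two (q : Prop) [Decidable q] :
    Nat.card {x : ZMod 2 // ¬ q → x = 0} = 2 ^ (if q then 1 else 0) := by
  by_cases h : q
  · simp [h]
  · simp [h]

theorem card_pi_mode (n : Fin 10 → ℕ) (q : Fin 10 → Prop) [DecidablePred q] :
    Nat.card (∀ i : Σ m, Fin (n m), {x : ZMod 2 // ¬ q i.1 → x = 0}) =
      2 ^ ∑ m with q m, n m := by
  rw [Nat.card_pi]
  simp_rw [card_subtype_zmod_two, Finset.prod_pow_eq_pow_sum]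
  congr 1
  rw [← Finset.univ_sigma_univ, Finset.sum_sigma, Finset.sum_filter]
  exact Finset.sum_congr rfl fun m _ => by by_cases h : q m <;> simp [h]

theorem achievable_of_nineStrictBounds {R : Fin 5 → ℝ} (h0 : ∀ j, 0 ≤ R j)
    (h : NineStrictBounds R) : threeSenders.Achievable R := by
  obtain ⟨δ, hδ0, hδ1, hδ⟩ := h.exists_smul
  have ht : 0 < 1 - δ := sub_pos.2 hδ1
  obtain ⟨μ, hμ, hload, hrate⟩ := hδ.exists_weights fun j =>
    mul_nonneg (inv_nonneg.2 ht.le) (h0 j)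
  -- The weights carry `R / (1 - δ)`, which leaves slack at every positive rate.
  have hrate' : ∀ j, R j = 0 ∨ R j < ∑ m with j ∈ modeMsgs m, μ m := fun j => by
    rcases (h0 j).eq_or_lt with hj | hj
    · exact Or.inl hj.symm
    · refine Or.inr (lt_of_lt_of_le ?_ (hrate j))
      exact lt_mul_of_one_lt_left hj ((one_lt_inv₀ ht).2 (by linarith))
  have hev : ∀ᶠ n : ℕ in atTop, ∀ j,
      ⌈(n : ℝ) * R j⌉₊ ≤ ∑ m with j ∈ modeMsgs m, ⌊(n : ℝ) * μ m⌋₊ := by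
    rw [eventually_all]
    intro j
    rcases hrate' j with hj | hj
    · simp [hj]
    -- The slack 11 covers at most 10 lost to the floors of the ten modes and less than 1 to the
    -- ceiling of `n * R j`.
    · obtain ⟨n₀, hn₀⟩ := exists_nat_gt (11 / (∑ m with j ∈ modeMsgs m, μ m - R j))
      filter_upwards [eventually_ge_atTop n₀] with n hn
      rw [div_lt_iff₀ (sub_pos.2 hj)] at hn₀
      have hn' : (n₀ : ℝ) ≤ n := Nat.cast_le.2 hn
      have h11 : 11 ≤ (n : ℝ) * (∑ m with j ∈ modeMsgs m, μ m - R j) :=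
        hn₀.le.trans (mul_le_mul_of_nonneg_right hn' (sub_pos.2 hj).le)
      have hfl : (n : ℝ) * ∑ m with j ∈ modeMsgs m, μ m - 10 ≤
          ∑ m with j ∈ modeMsgs m, (⌊(n : ℝ) * μ m⌋₊ : ℝ) := by
        have hc : (((Finset.univ.filter fun m => j ∈ modeMsgs m).card : ℕ) : ℝ) ≤ 10 := by
          exact_mod_cast Finset.card_le_univ _
        have : ∑ m with j ∈ modeMsgs m, ((n : ℝ) * μ m - 1) ≤
            ∑ m with j ∈ modeMsgs m, (⌊(n : ℝ) * μ m⌋₊ : ℝ) :=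
          Finset.sum_le_sum fun m _ => (Nat.sub_one_lt_floor _).le
        rw [Finset.sum_sub_distrib, ← Finset.mul_sum, Finset.sum_const, nsmul_eq_mul,
          mul_one] at this
        linarith
      have hlt := Nat.ceil_lt_add_one (mul_nonneg (Nat.cast_nonneg n) (h0 j))
      have : (⌈(n : ℝ) * R j⌉₊ : ℝ) ≤ ∑ m with j ∈ modeMsgs m, (⌊(n : ℝ) * μ m⌋₊ : ℝ) := by
        linarith
      exact_mod_cast this
  refine achievable_of_eventually h0 (hev.mono fun n hn => ?_)
  -- Mode `m` is run `⌊n * μ m⌋₊` times; served bits and link loads then add up in the exponents of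
  -- the alphabet sizes.
  refine (HasZeroErrorCode.pi (ι := Σ m, Fin ⌊(n : ℝ) * μ m⌋₊)
    fun i => hasZeroErrorCode_mode i.1).of_embedding (fun j => ?_) fun k => ?_
  · refine Classical.choice (Function.Embedding.nonempty_of_card_le ?_)
    rw [Fintype.card_fin, ← Nat.card_eq_fintype_card, card_pi_mode _ fun m => j ∈ modeMsgs m]
    exact Nat.pow_le_pow_right (by norm_num) (hn j)
  · refine Classical.choice (Function.Embedding.nonempty_of_card_le ?_)
    rw [Fintype.card_fin, ← Nat.card_eq_fintype_card, card_pi_mode _ fun m => k ∈ modeSenders m]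
    refine Nat.pow_le_pow_right (by norm_num) (Nat.le_floor ?_)
    rw [Nat.cast_sum]
    calc ∑ m with k ∈ modeSenders m, (⌊(n : ℝ) * μ m⌋₊ : ℝ)
        ≤ ∑ m with k ∈ modeSenders m, (n : ℝ) * μ m := Finset.sum_le_sum fun m _ =>
          Nat.floor_le (mul_nonneg (Nat.cast_nonneg n) (hμ m))
      _ ≤ (n : ℝ) * 1 := by
          rw [← Finset.mul_sum]
          exact mul_le_mul_of_nonneg_left (hload k) (Nat.cast_nonneg n)

theorem capacityRegion_threeSenders :
    threeSenders.capacityRegion = threeSenders.maisRegion := by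
  refine (capacityRegion_subset_maisRegion _).antisymm ?_
  rw [← closure_strict_eq]
  exact closure_mono fun R hR => achievable_of_nineStrictBounds hR.1 hR.2

end MultiSender

end

theorem mainTheorem6 :
    -- the MAIS outer bound of the instance, written out
    MultiSender.threeSenders.maisRegion =
      {R : Fin 5 → ℝ | (∀ j, 0 ≤ R j) ∧ R 2 ≤ 2 ∧ R 4 ≤ 1 ∧
        R 0 + R 2 ≤ 3 ∧ R 0 + R 4 ≤ 2 ∧ R 3 + R 4 ≤ 2 ∧
        R 0 + R 1 + R 4 ≤ 3 ∧ R 0 + R 3 + R 4 ≤ 3 ∧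
        R 1 + R 3 + R 4 ≤ 3 ∧ R 2 + R 3 + R 4 ≤ 3} ∧
    -- CCC with the three pairs of senders and split links
    MultiSender.Problem.IsGrouping MultiSender.senderPairs ∧
    MultiSender.threeSenders.cccRegion MultiSender.senderPairs =
      {R : Fin 5 → ℝ | (∀ j, 0 ≤ R j) ∧ R 2 < 2 ∧ R 4 < 1 ∧
        R 0 + R 2 < 3 ∧ R 0 + R 4 < 2 ∧ R 3 + R 4 < 2 ∧
        R 0 + R 1 + R 4 < 3 ∧ R 0 + R 3 + R 4 < 3 ∧
        R 1 + R 3 + R 4 < 3 ∧ R 2 + R 3 + R 4 < 3} ∧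
    -- it attains the outer bound, which is the capacity region
    closure (MultiSender.threeSenders.cccRegion MultiSender.senderPairs) =
      MultiSender.threeSenders.maisRegion ∧
    closure MultiSender.threeSenders.regionCLS = MultiSender.threeSenders.maisRegion ∧
    MultiSender.threeSenders.capacityRegion = MultiSender.threeSenders.maisRegion ∧
    -- CCC with sender partitioning only does not attain it
    (![3 / 2, 1, 3 / 2, 1, 1 / 2] : Fin 5 → ℝ) ∈ MultiSender.threeSenders.maisRegion ∧
    (![3 / 2, 1, 3 / 2, 1, 1 / 2] : Fin 5 → ℝ) ∉ closure MultiSender.threeSenders.regionCS ∧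
    MultiSender.threeSenders.regionCS ⊂ MultiSender.threeSenders.regionCLS ∧
    -- nor does DCC with joint link-and-sender partitioning
    MultiSender.threeSenders.regionLS ⊂ MultiSender.threeSenders.regionCLS ∧
    closure MultiSender.threeSenders.regionLS ⊂ MultiSender.threeSenders.capacityRegion ∧
    -- both inclusions hold for every problem
    (∀ (K N : ℕ) (p : MultiSender.Problem K N),
      p.regionCS ⊆ p.regionCLS ∧ p.regionLS ⊆ p.regionCLS) := by
  refine ⟨MultiSender.maisRegion_threeSenders, MultiSender.isGrouping_senderPairs,
    MultiSender.cccRegion_senderPairs, MultiSender.closure_cccRegion_senderPairs,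
    MultiSender.closure_regionCLS, MultiSender.capacityRegion_threeSenders,
    MultiSender.mem_maisRegion_of_regionCS_gap, MultiSender.notMem_closure_regionCS,
    MultiSender.regionCS_ssubset_regionCLS, MultiSender.regionLS_ssubset_regionCLS, ?_,
    fun K N p => ⟨p.regionCS_subset_regionCLS, p.regionLS_subset_regionCLS⟩⟩
  rw [MultiSender.capacityRegion_threeSenders]
  exact MultiSender.closure_regionLS_ssubset_maisRegion
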